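/- **Conventions.** Boxes of Young diagrams are drawn in English notation; the box in row $i$ and column $j$ has content $c(\square)=j-i$. For a partition $\lambda=(\lambda_1,\dots,\lambda_r)$ (possibly empty, with $\lambda_1:=0$ then) put $n_\lambda=|\lambda|+\lambda_1$, let $\lambda^{(n)}=(n-|\lambda|,\lambda_1,\dots,\lambda_r)$ for $n\ge n_\lambda$, and $\lambda^{(\infty)}=\bigcup_{n\ge n_\lambda}\lambda^{(n)}$. Let $\Omega(\lambda)$ be the set of labellings $T:\lambda^{(\infty)}\to\mathbb Z_{\ge0}$ with finitely many nonzero values that are weakly decreasing along rows (left to right) and strictly decreasing along columns (top to bottom); $\mathrm{rk}(T)$ is the least $n\ge n_\lambda$ such that $T$ vanishes outside $\lambda^{(n)}$. Formal products $iq^a$ ($i\ge1$, $a\ge0$) are ordered by $jq^m<kq^\ell$ iff $m>\ell$, or $m=\ell$ and $j<k$. For a partition $\mu$ of $n$, $\mathrm{PSYT}(\mu)$ is the set of labellings $\tau:\mu\to\{jq^b:1\le j\le n,\ b\ge 0\}$, strictly increasing along rows and columns, in which each $j\in\{1,\dots,n\}$ occurs in exactly one box. It is partially ordered by the relation generated by: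 $\Psi(\tau)>\tau$, where $\Psi$ replaces each label $kq^a$ with $k\ge2$ by $(k-1)q^a$ and $1q^a$ by $nq^{a+1}$; and $s_i(\tau)>\tau$, where $s_i$ exchanges the numbers $i$ and $i+1$ and leaves the exponents in place, whenever the exponents $w(i),w(i+1)$ and contents $c(i),c(i+1)$ of the boxes of $\tau$ containing $i$ and $i+1$ satisfy $w(i)<w(i+1)$, or $w(i)=w(i+1)$ and $c(i)-c(i+1)>1$. For $T\in\Omega(\lambda)$ and $n=\mathrm{rk}(T)$, let $\mathrm{Min}(T)$ be the (unique) least element among the $\tau\in\mathrm{PSYT}(\lambda^{(n)})$ whose exponents of $q$ are given by $T|_{\lambda^{(n)}}$, and let $\mu_T$ be the composition of $n$ whose Young subgroup is generated by the $s_i$ for which $i$ and $i+1$ occur in $\mathrm{Min}(T)$ in the same row and with the same exponent of $q$. $\mathrm{APSYT}(\lambda;T)$ is the set of labellings $\tau:\lambda^{(\infty)}\to\{iq^a:i\ge1,a\ge0\}$, strictly increasing along rows and columns, in which each $i\ge1$ occurs in exactly one box and in which the exponent of $q$ in box $\square$ is $T(\square)$. If $\tau$ is such a tableau, on $\lambda^{(\infty)}$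 or on $\lambda^{(n)}$, with exponents given by $T$, then $\mathrm{Inv}(\tau)$ is the set of pairs of boxes $(\square_1,\square_2)$ such that $\square_1$ strictly precedes $\square_2$ in the order in which larger values of $T$ come first and ties are broken column by column from left to right, top to bottom within a column, and such that $\tau(\square_1)=iq^a$, $\tau(\square_2)=jq^b$ with $i>j$. Put $\mathrm{inv}(\tau)=|\mathrm{Inv}(\tau)|$ and $\mathrm I(T)=\mathrm{Inv}(\mathrm{Min}(T))$. Finally $[m]_t!=\prod_{i=1}^m\frac{1-t^i}{1-t}$ and $[\mu]_t!=\prod_k[\mu_k]_t!$. **Theorem.** Let $\lambda$ be a partition and $T\in\Omega(\lambda)$. Then $\mathrm{Min}(T)$ exists and is unique, $\mathrm{Inv}(\tau)$ is finite for every $\tau\in\mathrm{APSYT}(\lambda;T)$, and the following equality holds in $\mathbb Q(q)((t))$, the series on the right being $t$-adically convergent: $$\frac{\prod_{\square\in\lambda^{(\mathrm{rk}(T))}}\left(1-q^{-T(\square)}t^{\mathrm{rk}(T)-|\lambda|-c(\square)}\right)}{(1-t)^{\mathrm{rk}(T)}[\mu_T]_t!}\prod_{(\square_1,\square_2)\in\mathrm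 I(T)}\frac{1-q^{T(\square_2)-T(\square_1)}t^{c(\square_2)-c(\square_1)}}{1-q^{T(\square_2)-T(\square_1)}t^{c(\square_2)-c(\square_1)+1}}$$ $$=\sum_{\tau\in\mathrm{APSYT}(\lambda;T)}t^{\mathrm{inv}(\tau)}\prod_{(\square_1,\square_2)\in\mathrm{Inv}(\tau)}\frac{1-q^{T(\square_2)-T(\square_1)}t^{c(\square_2)-c(\square_1)-1}}{1-q^{T(\square_2)-T(\square_1)}t^{c(\square_2)-c(\square_1)+1}}.$$ -/

import Mathlib

namespace VVMac

/-! ### Boxes, diagrams and contents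

A partition is a `YoungDiagram`; the box `(i, j)` lies in row `i` and column `j`, both counted
from `0` (English notation). -/

/-- The content of a box: column minus row. -/
def content (b : ℕ × ℕ) : ℤ := (b.2 : ℤ) - (b.1 : ℤ)

/-- The set of boxes of a Young diagram. -/
abbrev boxes (μ : YoungDiagram) : Set (ℕ × ℕ) := (μ.cells : Set (ℕ × ℕ))

/-- `n_λ = |λ| + λ₁`. -/
def nMin (lam : YoungDiagram) : ℕ := lam.card + lam.rowLen 0

/-- `λ^{(n)} = (n - |λ|, λ₁, λ₂, …)`, for `n ≥ n_λ`. (The `max` has no effect for `n ≥ n_λ`; for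
smaller `n`, which are never used, the value is `λ^{(n_λ)}`.) -/
def pad (lam : YoungDiagram) (n : ℕ) : YoungDiagram where
  cells := ({0} ×ˢ Finset.range (max (n - lam.card) (lam.rowLen 0))) ∪
    lam.cells.image (fun b => (b.1 + 1, b.2))
  isLowerSet := by
    rintro ⟨i, j⟩ ⟨i', j'⟩ hle hmem
    obtain ⟨h1, h2⟩ := Prod.mk_le_mk.mp hle
    simp only [Finset.coe_union, Set.mem_union, Finset.mem_coe, Finset.mem_product,
      Finset.mem_singleton, Finset.mem_range, Finset.mem_image, Prod.mk.injEq,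
      YoungDiagram.mem_cells, Prod.exists] at hmem ⊢
    rcases hmem with ⟨h0, hj⟩ | ⟨a, b, hab, ha, hb⟩
    · left
      exact ⟨by omega, by omega⟩
    · subst ha hb
      rcases Nat.eq_zero_or_pos i' with h0 | h0
      · left
        have h3 : (0, b) ∈ lam := lam.up_left_mem (Nat.zero_le a) le_rfl hab
        rw [YoungDiagram.mem_iff_lt_rowLen] at h3
        refine ⟨h0, ?_⟩
        have := le_max_right (n - lam.card) (lam.rowLen 0)
        omega
      · right
        exact ⟨i' - 1, j', lam.up_left_mem (by omega) h2 hab, by omega, rfl⟩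

/-- `λ^{(∞)}`, the union of all `λ^{(n)}` with `n ≥ n_λ`. -/
def padInf (lam : YoungDiagram) : Set (ℕ × ℕ) := ⋃ n ≥ nMin lam, boxes (pad lam n)

theorem pad_subset_padInf (lam : YoungDiagram) (n : ℕ) : boxes (pad lam n) ⊆ padInf lam := by
  intro b hb
  simp only [padInf, Set.mem_iUnion]
  refine ⟨max n (nMin lam), le_max_right _ _, ?_⟩
  rw [Finset.mem_coe, pad, Finset.mem_union, Finset.mem_product, Finset.mem_singleton,
    Finset.mem_range] at hb ⊢
  rcases hb with ⟨h0, hj⟩ | hb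
  · left
    exact ⟨h0, lt_of_lt_of_le hj (max_le_max (Nat.sub_le_sub_right (le_max_left _ _) _) le_rfl)⟩
  · exact Or.inr hb

/-! ### Labels and labellings -/

/-- The formal product `i q^a`, with `idx = i` and `exp = a`. -/
@[ext]
structure PLabel where
  idx : ℕ
  exp : ℕ

/-- `j q^m < k q^l` iff `m > l`, or `m = l` and `j < k`. -/
instance : LT PLabel where
  lt x y := y.exp < x.exp ∨ (x.exp = y.exp ∧ x.idx < y.idx)

section Labellings

variable {D : Set (ℕ × ℕ)}

/-- Strictly increasing along rows and columns. -/
def StrictlyIncreasing (τ : D → PLabel) : Prop :=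
  (∀ b b' : D, b.1.1 = b'.1.1 → b.1.2 < b'.1.2 → τ b < τ b') ∧
  (∀ b b' : D, b.1.2 = b'.1.2 → b.1.1 < b'.1.1 → τ b < τ b')

/-- The labelling `𝔭(τ)` by the exponents of `q`. -/
def expo (τ : D → PLabel) : D → ℕ := fun b => (τ b).exp

/-- `b` comes before `b'` in the column-standard labelling: columns from left to right, each
column from top to bottom. -/
def ColBefore (b b' : ℕ × ℕ) : Prop := b.2 < b'.2 ∨ (b.2 = b'.2 ∧ b.1 < b'.1)

/-- The strict order on boxes that defines `S(T)`: larger values of `T` come first, ties are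
broken by the column-standard labelling. -/
def Precedes (T : D → ℕ) (b b' : D) : Prop :=
  T b' < T b ∨ (T b = T b' ∧ ColBefore b.1 b'.1)

/-- The standard labelling `S(T)`, which numbers the boxes `1, 2, 3, …` in the order
`Precedes T`. -/
noncomputable def stdLabel (T : D → ℕ) (b : D) : ℕ := {b' : D | Precedes T b' b}.ncard + 1

/-- The set `Inv(τ)` of inversion pairs of `τ`. -/
def Inv (τ : D → PLabel) : Set (D × D) :=
  {p | stdLabel (expo τ) p.1 < stdLabel (expo τ) p.2 ∧ (τ p.2).idx < (τ p.1).idx}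

/-- The labelling `s_j(τ)`: the numbers `j` and `j + 1` are exchanged, exponents stay in place. -/
def swapLabel (j : ℕ) (τ : D → PLabel) : D → PLabel := fun b =>
  if (τ b).idx = j then ⟨j + 1, (τ b).exp⟩
  else if (τ b).idx = j + 1 then ⟨j, (τ b).exp⟩
  else τ b

/-- The labelling `Ψ(τ)` (for `n` boxes): `k q^a` becomes `(k-1) q^a` if `k ≥ 2`, and `1 q^a`
becomes `n q^{a+1}`. -/
def psiLabel (n : ℕ) (τ : D → PLabel) : D → PLabel := fun b =>
  if 2 ≤ (τ b).idx then ⟨(τ b).idx - 1, (τ b).exp⟩ else ⟨n, (τ b).exp + 1⟩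

end Labellings

/-! ### Periodic standard Young tableaux and their order -/

/-- Non-negative periodic standard Young tableaux of shape `μ`. -/
structure PSYT (μ : YoungDiagram) where
  label : boxes μ → PLabel
  idx_mem : ∀ b, (label b).idx ∈ Finset.Icc 1 μ.card
  existsUnique_idx : ∀ j ∈ Finset.Icc 1 μ.card, ∃! b, (label b).idx = j
  strict : StrictlyIncreasing label

/-- The generating relations `τ < τ'` of the partial order on `PSYT(μ)`. -/
inductive Cover {μ : YoungDiagram} : PSYT μ → PSYT μ → Prop
  | psi (τ τ' : PSYT μ) (h : τ'.label = psiLabel μ.card τ.label) : Cover τ τ'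
  | swap_exp (τ τ' : PSYT μ) (i : ℕ) (b₁ b₂ : boxes μ)
      (h₁ : (τ.label b₁).idx = i) (h₂ : (τ.label b₂).idx = i + 1)
      (hw : (τ.label b₁).exp < (τ.label b₂).exp)
      (h : τ'.label = swapLabel i τ.label) : Cover τ τ'
  | swap_content (τ τ' : PSYT μ) (i : ℕ) (b₁ b₂ : boxes μ)
      (h₁ : (τ.label b₁).idx = i) (h₂ : (τ.label b₂).idx = i + 1)
      (hw : (τ.label b₁).exp = (τ.label b₂).exp)
      (hc : 1 < content b₁.1 - content b₂.1)
      (h : τ'.label = swapLabel i τ.label) : Cover τ τ'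

/-- The partial order on `PSYT(μ)`. -/
instance (μ : YoungDiagram) : LE (PSYT μ) where
  le := Relation.ReflTransGen Cover

/-- `M` is `Min(T)`: the least element of `PSYT(μ; T) = {τ ∈ PSYT(μ) : 𝔭(τ) = T}`. -/
def IsMinTableau {μ : YoungDiagram} (T : boxes μ → ℕ) (M : PSYT μ) : Prop :=
  expo M.label = T ∧ ∀ τ : PSYT μ, expo τ.label = T → M ≤ τ

/-- The numbers `i` and `i + 1` occur in the same row of `M` with the same power of `q`. -/
def Joined {μ : YoungDiagram} (M : PSYT μ) (i : ℕ) : Prop :=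
  ∃ b b' : boxes μ, (M.label b).idx = i ∧ (M.label b').idx = i + 1 ∧
    b.1.1 = b'.1.1 ∧ (M.label b).exp = (M.label b').exp

open Classical in
/-- For `M = Min(T)` this is the composition `μ(T)` of `n`: its Young subgroup is generated by the
`s_i` with `Joined M i`, that is, `{1, …, n}` is cut between `i` and `i + 1` exactly when
`Joined M i` fails. -/
noncomputable def muComp {μ : YoungDiagram} (M : PSYT μ) : Composition μ.card :=
  CompositionAsSet.toComposition
    { boundaries := Finset.univ.filter
        (fun i => i = 0 ∨ i = Fin.last μ.card ∨ ¬ Joined M (i : ℕ))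
      zero_mem := by simp
      getLast_mem := by simp }

/-! ### Labellings of the infinite diagram -/

/-- The set `Ω(λ)`. -/
structure Omega (lam : YoungDiagram) where
  val : padInf lam → ℕ
  finite_support : {b | val b ≠ 0}.Finite
  row_weak : ∀ b b' : padInf lam, b.1.1 = b'.1.1 → b.1.2 < b'.1.2 → val b' ≤ val b
  col_strict : ∀ b b' : padInf lam, b.1.2 = b'.1.2 → b.1.1 < b'.1.1 → val b' < val b

/-- The restriction of `T` to `λ^{(n)}`. -/
def Omega.restrict {lam : YoungDiagram} (T : Omega lam) (n : ℕ) : boxes (pad lam n) → ℕ :=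
  fun b => T.val ⟨b.1, pad_subset_padInf lam n b.2⟩

/-- The rank `rk(T)`: the least `n ≥ n_λ` such that `T` vanishes outside `λ^{(n)}`. -/
noncomputable def Omega.rk {lam : YoungDiagram} (T : Omega lam) : ℕ :=
  sInf {n | nMin lam ≤ n ∧ ∀ b : padInf lam, b.1 ∉ boxes (pad lam n) → T.val b = 0}

/-- Non-negative asymptotic periodic standard Young tableaux with base shape `λ`. -/
structure APSYT (lam : YoungDiagram) where
  label : padInf lam → PLabel
  idx_pos : ∀ b, 1 ≤ (label b).idx
  strict : StrictlyIncreasing label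
  finite_exp : {b | 0 < (label b).exp}.Finite
  existsUnique_idx : ∀ i, 1 ≤ i → ∃! b, (label b).idx = i

/-- The set `APSYT(λ; T)`. -/
def APSYTOver {lam : YoungDiagram} (T : Omega lam) : Type :=
  {τ : APSYT lam // expo τ.label = T.val}

/-! ### The field `ℚ(q)((t))` -/

/-- The field `ℚ(q)((t))`, with the `t`-adic topology that Mathlib puts on Laurent series. -/
abbrev Kqt : Type := LaurentSeries (RatFunc ℚ)

noncomputable def q : Kqt := HahnSeries.C RatFunc.X

noncomputable def t : Kqt := HahnSeries.single 1 1

/-- `[n]_t! = ∏_{i=1}^n (1 - t^i) / (1 - t)`. -/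
noncomputable def tFactorial (n : ℕ) : Kqt := ∏ i ∈ Finset.Icc 1 n, (1 - t ^ i) / (1 - t)

/-- `[μ]_t! = [μ₁]_t! [μ₂]_t! ⋯` for a composition `μ`. -/
noncomputable def tFactorialComp {n : ℕ} (μ : Composition n) : Kqt :=
  (μ.blocks.map tFactorial).prod

/-- `1 - q^{T(b₂) - T(b₁)} t^{c(b₂) - c(b₁) + k}`, for the pair `p = (b₁, b₂)`. -/
noncomputable def pairFactor {D : Set (ℕ × ℕ)} (T : D → ℕ) (p : D × D) (k : ℤ) : Kqt :=
  1 - q ^ ((T p.2 : ℤ) - (T p.1 : ℤ)) * t ^ (content p.2.1 - content p.1.1 + k)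

/-- The product side of the identity, with `M` in the place of `Min(T|_{λ^{(rk T)}})`. -/
noncomputable def productSide {lam : YoungDiagram} (T : Omega lam) (M : PSYT (pad lam T.rk)) :
    Kqt :=
  (∏ b : boxes (pad lam T.rk),
      (1 - q ^ (-(T.restrict T.rk b : ℤ)) * t ^ ((T.rk : ℤ) - (lam.card : ℤ) - content b.1))) /
    ((1 - t) ^ T.rk * tFactorialComp (muComp M)) *
  ∏ᶠ p ∈ Inv M.label, pairFactor (T.restrict T.rk) p 0 / pairFactor (T.restrict T.rk) p 1

/-- The summand of the series side that belongs to `τ ∈ APSYT(λ; T)`. -/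
noncomputable def seriesTerm {lam : YoungDiagram} (T : Omega lam) (τ : APSYTOver T) : Kqt :=
  t ^ (Inv τ.1.label).ncard *
    ∏ᶠ p ∈ Inv τ.1.label, pairFactor T.val p (-1) / pairFactor T.val p 1

end VVMac

/-!
Give the box `b` of `λ^{(∞)}` the node `x_b = q^{T(b)} t^{c(b)}`, and list the boxes in the order
`Precedes T`. A tableau over `T` amounts to a permutation of `ℕ` that puts `x` before `t x` whenever
both are nodes, and its term in the series is the product of `(t x_i - x_j) / (x_i - t x_j)` over
the inversions `i < j`. This product vanishes for all other permutations, so the series may be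
extended over all permutations of `{0, …, N - 1}`, with `N → ∞`. For fixed `N` the sum is evaluated
by Macdonald's identity `∑_σ ∏_{i<j} (x_{σ i} - t x_{σ j}) / (x_{σ i} - x_{σ j}) = [N]_t!`, an
instance of Lagrange interpolation. The nodes from `rk(T)` on form a geometric progression of ratio
`t`, so all but the first `rk(T)` of the resulting products telescope, and the rest converges
`t`-adically. The series itself converges because almost all inversion factors are `O(t)` and only
finitely many permutations have a given number of inversions.

`Min(T)` numbers the boxes by increasing values of `T`, row by row: exchanging `i` and `i + 1` where
a tableau over `T` deviates from this order moves down in the partial order. The pairs of boxes that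
`Min(T)` does not invert lie in a common row with a common value of `T`, and contribute
`1 / [μ_T]_t!` to the limit.
-/

namespace VVMac

open Finset Filter Topology

section Symmetrization

variable {K : Type*} [Field K]

open Polynomial in
/-- This is Lagrange interpolation of `∏ (X - t x_b) - ∏ (X - x_b)` at the nodes `x_a`,
evaluated at `0`. -/
theorem sum_prod_erase_div {ι : Type*} [DecidableEq ι] {s : Finset ι} {x : ι → K} {t : K}
    (ht : t ≠ 1) (hx : ∀ i ∈ s, x i ≠ 0) (hinj : Set.InjOn x s) :
    ∑ a ∈ s, ∏ b ∈ s.erase a, (x a - t * x b) / (x a - x b) = (1 - t ^ #s) / (1 - t) := by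
  set P := Lagrange.nodal s (fun b => t * x b) - Lagrange.nodal s x with hP
  have hdeg : P.degree < #s := by
    simpa only [Lagrange.degree_nodal] using
      degree_sub_lt_left (p := Lagrange.nodal s (fun b => t * x b)) (q := Lagrange.nodal s x)
        (by simp [Lagrange.degree_nodal]) Lagrange.nodal_ne_zero
        (by rw [Lagrange.nodal_monic.leadingCoeff, Lagrange.nodal_monic.leadingCoeff])
  have hprod : ∏ b ∈ s, (0 - x b) ≠ 0 :=
    prod_ne_zero_iff.mpr fun b hb => by simpa using hx b hb
  have hvalue : eval 0 P = t ^ #s * ∏ b ∈ s, (0 - x b) - ∏ b ∈ s, (0 - x b) := by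
    rw [hP, eval_sub, Lagrange.eval_nodal, Lagrange.eval_nodal, ← prod_const, ← prod_mul_distrib]
    exact congrArg₂ _ (prod_congr rfl fun b _ => by ring) rfl
  have hterm : ∀ a ∈ s, eval 0 (C (eval (x a) P) * Lagrange.basis s x a) =
      -((1 - t) * (∏ b ∈ s, (0 - x b)) *
        ∏ b ∈ s.erase a, (x a - t * x b) / (x a - x b)) := by
    intro a ha
    have hbasis : ∀ b ∈ s.erase a, eval 0 (Lagrange.basisDivisor (x a) (x b)) =
        (0 - x b) / (x a - x b) := fun b _ => by
      simp only [Lagrange.basisDivisor, eval_mul, eval_C, eval_sub, eval_X]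
      ring
    rw [hP, eval_mul, eval_C, eval_sub, Lagrange.eval_nodal_at_node ha, sub_zero,
      Lagrange.eval_nodal, Lagrange.basis, eval_prod, ← mul_prod_erase s _ ha,
      ← mul_prod_erase s _ ha, prod_congr rfl hbasis, prod_div_distrib, prod_div_distrib]
    ring
  have hinterp := congrArg (eval 0) (Lagrange.eq_interpolate hinj hdeg)
  rw [Lagrange.interpolate_apply, eval_finsetSum, sum_congr rfl hterm, sum_neg_distrib,
    ← mul_sum, hvalue] at hinterp
  rw [eq_div_iff (sub_ne_zero.mpr ht.symm)]
  exact mul_left_cancel₀ hprod (by linear_combination hinterp)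

theorem prod_swap_zero_succ {M : Type*} [CommMonoid M] {n : ℕ} (a : Fin (n + 1))
    (f : Fin (n + 1) → M) :
    ∏ k : Fin n, f (Equiv.swap 0 a k.succ) = ∏ b ∈ univ.erase a, f b := by
  have himage : (univ.map (Fin.succEmb n)).map (Equiv.swap 0 a).toEmbedding = univ.erase a := by
    ext b
    simp [Finset.mem_map_equiv, Equiv.symm_swap, Fin.exists_succ_eq, Equiv.swap_apply_eq_iff]
  rw [← himage, prod_map, prod_map]
  rfl

theorem sum_perm_prod_div {t : K} (ht : t ≠ 1) {n : ℕ} {x : Fin n → K} (hx : ∀ i, x i ≠ 0)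
    (hinj : Function.Injective x) :
    ∑ σ : Equiv.Perm (Fin n), ∏ i, ∏ j ∈ Ioi i, (x (σ i) - t * x (σ j)) / (x (σ i) - x (σ j)) =
      ∏ i ∈ range n, (1 - t ^ (i + 1)) / (1 - t) := by
  induction n with
  | zero => simp
  | succ n ih =>
    have hfirst : ∀ a : Fin (n + 1), ∑ e : Equiv.Perm (Fin n), ∏ i, ∏ j ∈ Ioi i,
        (x (Equiv.Perm.decomposeFin.symm (a, e) i) -
          t * x (Equiv.Perm.decomposeFin.symm (a, e) j)) /
        (x (Equiv.Perm.decomposeFin.symm (a, e) i) - x (Equiv.Perm.decomposeFin.symm (a, e) j)) =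
        (∏ b ∈ univ.erase a, (x a - t * x b) / (x a - x b)) *
          ∏ i ∈ range n, (1 - t ^ (i + 1)) / (1 - t) := by
      intro a
      rw [← ih (x := fun k => x (Equiv.swap 0 a k.succ)) (fun i => hx _)
        (hinj.comp ((Equiv.injective _).comp (Fin.succ_injective n))), mul_sum]
      refine sum_congr rfl fun e _ => ?_
      simp only [Fin.prod_univ_succ, Fin.prod_Ioi_zero, Fin.prod_Ioi_succ,
        Equiv.Perm.decomposeFin_symm_apply_zero, Equiv.Perm.decomposeFin_symm_apply_succ]
      rw [Equiv.prod_comp e (fun k => (x a - t * x (Equiv.swap 0 a k.succ)) /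
        (x a - x (Equiv.swap 0 a k.succ))),
        prod_swap_zero_succ a (fun b => (x a - t * x b) / (x a - x b))]
    rw [← Equiv.sum_comp Equiv.Perm.decomposeFin.symm, Fintype.sum_prod_type,
      sum_congr rfl fun a _ => hfirst a, ← sum_mul,
      sum_prod_erase_div ht (fun i _ => hx i) hinj.injOn, prod_range_succ, card_univ,
      Fintype.card_fin, mul_comm]

theorem prod_Ioi_perm {M ι : Type*} [CommMonoid M] [LinearOrder ι] [Fintype ι]
    [LocallyFiniteOrderTop ι] (σ : Equiv.Perm ι) (f : ι → ι → M) :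
    ∏ i, ∏ j ∈ Ioi i, f (σ i) (σ j) =
      ∏ i, ∏ j ∈ Ioi i, if σ.symm j < σ.symm i then f j i else f i j := by
  simp only [prod_sigma']
  refine prod_bij' (fun p _ => ⟨min (σ p.1) (σ p.2), max (σ p.1) (σ p.2)⟩)
    (fun p _ => ⟨min (σ.symm p.1) (σ.symm p.2), max (σ.symm p.1) (σ.symm p.2)⟩) ?_ ?_ ?_ ?_ ?_
  all_goals
    rintro ⟨i, j⟩ hij
    simp only [mem_sigma, mem_univ, mem_Ioi, true_and] at hij
  · simp [hij.ne']
  · simp [hij.ne']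
  · rcases lt_or_gt_of_ne (σ.injective.ne hij.ne) with h | h <;>
      simp [h.le, hij.le]
  · rcases lt_or_gt_of_ne (σ.symm.injective.ne hij.ne) with h | h <;>
      simp [h.le, hij.le]
  · rcases lt_or_gt_of_ne (σ.injective.ne hij.ne) with h | h <;>
      simp [h.le, hij, hij.not_gt]

/-- The weight of an inversion between nodes `a` and `b`. -/
def invWeight (t a b : K) : K := (t * a - b) / (a - t * b)

/-- The factor that a pair of nodes `a`, `b` contributes to the value of the sum over all
permutations. -/
def pairRatio (t a b : K) : K := (a - b) / (a - t * b)

theorem div_mul_pairRatio {t a b : K} (hab : a ≠ b) (h : a ≠ t * b) :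
    (a - t * b) / (a - b) * pairRatio t a b = 1 := by
  rw [pairRatio, div_mul_div_cancel₀ (sub_ne_zero.mpr hab), div_self (sub_ne_zero.mpr h)]

theorem div_mul_pairRatio_swap {t a b : K} (hab : a ≠ b) :
    (b - t * a) / (b - a) * pairRatio t a b = invWeight t a b := by
  rw [pairRatio, invWeight, ← neg_sub a b, div_neg, ← neg_div, neg_sub,
    div_mul_div_cancel₀ (sub_ne_zero.mpr hab)]

theorem sum_perm_prod_invWeight {t : K} (ht : t ≠ 1) {n : ℕ} {x : Fin n → K}
    (hx : ∀ i, x i ≠ 0) (hinj : Function.Injective x) (hd : ∀ i j, i < j → x i ≠ t * x j) :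
    ∑ π : Equiv.Perm (Fin n), ∏ i, ∏ j ∈ Ioi i,
      (if π j < π i then invWeight t (x i) (x j) else 1) =
      (∏ i ∈ range n, (1 - t ^ (i + 1)) / (1 - t)) *
        ∏ i, ∏ j ∈ Ioi i, pairRatio t (x i) (x j) := by
  rw [← sum_perm_prod_div ht hx hinj, sum_mul,
    ← Equiv.sum_comp (Equiv.inv (Equiv.Perm (Fin n)))]
  refine sum_congr rfl fun σ _ => ?_
  rw [prod_Ioi_perm σ fun i j => (x i - t * x j) / (x i - x j)]
  simp only [← prod_mul_distrib, Equiv.inv_apply, Equiv.Perm.inv_def]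
  refine prod_congr rfl fun i _ => prod_congr rfl fun j hj => ?_
  have hij : i < j := mem_Ioi.mp hj
  have hne : x i ≠ x j := hinj.ne hij.ne
  split_ifs
  · exact (div_mul_pairRatio_swap hne).symm
  · exact (div_mul_pairRatio hne (hd i j hij)).symm

end Symmetrization

section Permutations

/-- The set of inversions of a permutation of `ℕ`. -/
def invSet (π : Equiv.Perm ℕ) : Set (ℕ × ℕ) := {p | p.1 < p.2 ∧ π p.2 < π p.1}

/-- The permutations of `Fin N` as the permutations of `ℕ` that fix every number from `N` on. -/
def permFinEquiv (N : ℕ) : Equiv.Perm (Fin N) ≃ {π : Equiv.Perm ℕ // ∀ i, ¬ i < N → π i = i} :=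
  Fin.equivSubtype.permCongr.trans (Equiv.Perm.subtypeEquivSubtypePerm (· < N))

/-- The finite set of permutations of `ℕ` that fix every number from `N` on. -/
def permsBelow (N : ℕ) : Finset (Equiv.Perm ℕ) :=
  univ.map ((permFinEquiv N).toEmbedding.trans (Function.Embedding.subtype _))

theorem permFinEquiv_apply {N : ℕ} (σ : Equiv.Perm (Fin N)) (i : Fin N) :
    (permFinEquiv N σ).1 i = σ i :=
  Equiv.Perm.subtypeEquivSubtypePerm_apply_of_mem (p := (· < N)) _ i.2

theorem mem_permsBelow {N : ℕ} {π : Equiv.Perm ℕ} : π ∈ permsBelow N ↔ ∀ i, N ≤ i → π i = i := by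
  simp only [permsBelow, Finset.mem_map, mem_univ, true_and, ← not_lt]
  exact ⟨fun ⟨σ, h⟩ => h ▸ (permFinEquiv N σ).2,
    fun h => ⟨(permFinEquiv N).symm ⟨π, h⟩, by simp⟩⟩

theorem permsBelow_mono : Monotone permsBelow := fun _ _ hMN _ hπ =>
  mem_permsBelow.mpr fun i hi => mem_permsBelow.mp hπ i (hMN.trans hi)

theorem invSet_subset_of_mem_permsBelow {N : ℕ} {π : Equiv.Perm ℕ} (hπ : π ∈ permsBelow N) :
    invSet π ⊆ (range N ×ˢ range N : Finset (ℕ × ℕ)) := by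
  rintro ⟨i, j⟩ ⟨hij : i < j, hji : π j < π i⟩
  have hfix := mem_permsBelow.mp hπ
  have hj : j < N := by
    by_contra! hj
    have hi : π (π i) = π i := hfix _ (by rw [hfix j hj] at hji; omega)
    rw [π.injective hi, hfix j hj] at hji
    omega
  simpa using ⟨hij.trans hj, hj⟩

variable {π : Equiv.Perm ℕ} {n : ℕ}

theorem fst_lt_of_mem_invSet (hπ : StrictMonoOn π (Set.Ici n)) {p : ℕ × ℕ} (hp : p ∈ invSet π) :
    p.1 < n := by
  by_contra! hn
  exact (hπ hn (hn.trans hp.1.le) hp.1).not_gt hp.2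

theorem finite_invSet (hπ : StrictMonoOn π (Set.Ici n)) : (invSet π).Finite := by
  refine ((Set.finite_Iio n).biUnion fun i _ =>
    (Set.finite_singleton i).prod ((Set.finite_Iio (π i)).preimage π.injective.injOn)).subset ?_
  exact fun p hp => Set.mem_biUnion (fst_lt_of_mem_invSet hπ hp) ⟨rfl, hp.2⟩

theorem apply_le_self (hπ : StrictMonoOn π (Set.Ici n)) {i : ℕ} (hi : n ≤ i) : π i ≤ i := by
  have hmaps : Set.MapsTo π.symm (range (π i)) (range i) := by
    intro l hl
    simp only [coe_range, Set.mem_Iio] at hl ⊢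
    by_contra! hil
    have := hπ.monotoneOn hi (hi.trans hil) hil
    rw [Equiv.apply_symm_apply] at this
    omega
  simpa using card_le_card_of_injOn _ hmaps π.symm.injective.injOn

theorem exists_lt_apply_lt {i : ℕ} (hi : π i < i) : ∃ j < i, π i < π j := by
  by_contra! hle
  have hmaps : Set.MapsTo π (range i) (range (π i)) := by
    intro j hj
    simp only [coe_range, Set.mem_Iio] at hj ⊢
    exact (hle j hj).lt_of_ne (π.injective.ne hj.ne)
  have := card_le_card_of_injOn _ hmaps π.injective.injOn
  simp only [card_range] at this
  omega

/-- If `π` moves `i ≥ n`, some `j < n` is inverted with every number from `n` to `i`. -/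
theorem mem_permsBelow_add_ncard (hπ : StrictMonoOn π (Set.Ici n)) :
    π ∈ permsBelow (n + (invSet π).ncard) := by
  refine mem_permsBelow.mpr fun i hi => ?_
  by_contra hne
  have hni : n ≤ i := by omega
  obtain ⟨j, hji, hj⟩ := exists_lt_apply_lt ((apply_le_self hπ hni).lt_of_ne hne)
  have hjn : j < n := by
    by_contra! hnj
    exact (hπ hnj hni hji).not_gt hj
  have hsub : (({j} ×ˢ Icc n i : Finset (ℕ × ℕ)) : Set (ℕ × ℕ)) ⊆ invSet π := by
    rintro ⟨a, k⟩ hk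
    simp only [coe_product, coe_singleton, coe_Icc, Set.mem_prod, Set.mem_singleton_iff,
      Set.mem_Icc] at hk
    obtain ⟨rfl, hnk, hki⟩ := hk
    exact ⟨hjn.trans_le hnk, (hπ.monotoneOn hnk hni hki).trans_lt hj⟩
  have hcard := Set.ncard_le_ncard hsub (finite_invSet hπ)
  rw [Set.ncard_coe_finset, card_product, card_singleton, one_mul, Nat.card_Icc] at hcard
  omega

theorem tendsto_ncard_invSet (n : ℕ) :
    Tendsto (fun π : {π : Equiv.Perm ℕ // StrictMonoOn π (Set.Ici n)} => (invSet π.1).ncard)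
      cofinite atTop := by
  refine tendsto_atTop.mpr fun m => eventually_cofinite.mpr ?_
  refine ((permsBelow (n + m)).finite_toSet.preimage Subtype.val_injective.injOn).subset ?_
  exact fun π hπ => permsBelow_mono (by simp only [Set.mem_ofPred_eq] at hπ; omega)
    (mem_permsBelow_add_ncard π.2)

theorem finprod_invSet_permFinEquiv {M : Type*} [CommMonoid M] {N : ℕ} (f : ℕ → ℕ → M)
    (σ : Equiv.Perm (Fin N)) :
    ∏ᶠ p ∈ invSet (permFinEquiv N σ).1, f p.1 p.2 =
      ∏ i, ∏ j ∈ Ioi i, if σ j < σ i then f i j else 1 := by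
  set π := (permFinEquiv N σ).1 with hπ
  have hset : invSet π = ((range N ×ˢ range N).filter fun p => p.1 < p.2 ∧ π p.2 < π p.1 :
      Finset (ℕ × ℕ)) := by
    rw [coe_filter]
    exact Set.ext fun p => ⟨fun hp => ⟨invSet_subset_of_mem_permsBelow
      (mem_permsBelow.mpr fun i hi => (permFinEquiv N σ).2 i hi.not_gt) hp, hp⟩, And.right⟩
  rw [hset, finprod_mem_coe_finset, prod_filter, prod_product, prod_range]
  refine prod_congr rfl fun i _ => ?_
  rw [prod_range, ← filter_lt_eq_Ioi, prod_filter]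
  simp only [hπ, permFinEquiv_apply, Fin.val_fin_lt, ite_and]

end Permutations

section FiniteSum

variable {K : Type*} [Field K] {t : K} {x : ℕ → K} {n : ℕ}

theorem prod_fin_Ioi_eq_range {M : Type*} [CommMonoid M] {N : ℕ} (f : ℕ → ℕ → M) :
    ∏ i : Fin N, ∏ j ∈ Ioi i, f i j = ∏ j ∈ range N, ∏ i ∈ range j, f i j := by
  rw [prod_comm' (t' := univ) (s' := Iio) (by simp), prod_range]
  refine prod_congr rfl fun j _ => ?_
  rw [← Nat.Iio_eq_range, ← Fin.map_valEmbedding_Iio, prod_map]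
  rfl

/-- `π` lists `x_i` before `x_j` whenever `i < j` and `x_j = t x_i`. -/
def Straight (t : K) (x : ℕ → K) (π : Equiv.Perm ℕ) : Prop :=
  ∀ i j, i < j → x j = t * x i → π i < π j

theorem Straight.strictMonoOn_of_geometric {π : Equiv.Perm ℕ} (hπ : Straight t x π)
    (htail : ∀ k, x (n + k) = t ^ k * x n) : StrictMonoOn π (Set.Ici n) := by
  have hmono : StrictMono fun k => π (n + k) := strictMono_nat_of_lt_succ fun k =>
    hπ _ _ (by omega) (by rw [htail, htail, pow_succ]; ring)
  intro i (hi : n ≤ i) j (hj : n ≤ j) hij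
  obtain ⟨k, rfl⟩ := Nat.exists_eq_add_of_le hi
  obtain ⟨l, rfl⟩ := Nat.exists_eq_add_of_le hj
  exact hmono (by omega)

theorem finprod_invWeight_eq_zero {π : Equiv.Perm ℕ} (hfin : (invSet π).Finite)
    (h : ¬ Straight t x π) : ∏ᶠ p ∈ invSet π, invWeight t (x p.1) (x p.2) = 0 := by
  simp only [Straight, not_forall, not_lt] at h
  obtain ⟨i, j, hij, hx, hle⟩ := h
  rw [finprod_mem_eq_finite_toFinset_prod _ hfin]
  refine prod_eq_zero (i := (i, j)) ?_ (by rw [invWeight, hx, sub_self, zero_div])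
  exact hfin.mem_toFinset.mpr ⟨hij, hle.lt_of_ne (π.injective.ne hij.ne')⟩

theorem sum_permsBelow (ht : t ≠ 1) (hx : ∀ i, x i ≠ 0) (hinj : Function.Injective x)
    (hd : ∀ i j, i < j → x i ≠ t * x j) (N : ℕ) :
    ∑ π ∈ permsBelow N, ∏ᶠ p ∈ invSet π, invWeight t (x p.1) (x p.2) =
      (∏ i ∈ range N, (1 - t ^ (i + 1)) / (1 - t)) *
        ∏ j ∈ range N, ∏ i ∈ range j, pairRatio t (x i) (x j) := by
  rw [permsBelow, sum_map, ← prod_fin_Ioi_eq_range fun i j => pairRatio t (x i) (x j),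
    ← sum_perm_prod_invWeight (x := fun i : Fin N => x i) ht (fun i => hx i)
      (hinj.comp Fin.val_injective) (fun i j h => hd i j h)]
  exact sum_congr rfl fun σ _ =>
    finprod_invSet_permFinEquiv (fun i j => invWeight t (x i) (x j)) σ

theorem pow_ne_one_of_geometric (hinj : Function.Injective x)
    (htail : ∀ k, x (n + k) = t ^ k * x n) (k : ℕ) : t ^ (k + 1) ≠ 1 := fun hk => by
  have := hinj ((htail (k + 1)).trans (by rw [hk, one_mul]))
  omega

theorem pairRatio_mul_right {a b c : K} (hc : c ≠ 0) :
    pairRatio t (a * c) (b * c) = pairRatio t a b := by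
  rw [pairRatio, ← mul_assoc, ← sub_mul, ← sub_mul, mul_div_mul_right _ _ hc, pairRatio]

theorem prod_pairRatio_pow (ht0 : t ≠ 0) (ht : ∀ k : ℕ, t ^ (k + 1) ≠ 1) (k : ℕ) :
    ∏ i ∈ range k, pairRatio t (t ^ i) (t ^ k) = (1 - t) / (1 - t ^ (k + 1)) := by
  have hne : ∀ k : ℕ, 1 - t ^ (k + 1) ≠ 0 := fun k => sub_ne_zero.mpr (ht k).symm
  induction k with
  | zero => simpa using (div_self (by simpa using hne 0)).symm
  | succ k ih =>
    simp only [prod_range_succ', pow_succ _ k, pow_succ _ (_ : ℕ), pairRatio_mul_right ht0]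
    rw [ih, pairRatio, pow_zero, ← pow_succ, ← pow_succ', ← pow_succ, div_mul_div_cancel₀ (hne k)]

theorem prod_pairRatio_pow_mul {a y : K} (h : ∀ k : ℕ, a ≠ t ^ k * y) (k : ℕ) :
    ∏ i ∈ range k, pairRatio t a (t ^ i * y) = (a - y) / (a - t ^ k * y) := by
  induction k with
  | zero => simpa using (div_self (sub_ne_zero.mpr (by simpa using h 0))).symm
  | succ k ih =>
    rw [prod_range_succ, ih, pairRatio, ← mul_assoc, ← pow_succ',
      div_mul_div_cancel₀ (sub_ne_zero.mpr (h k))]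

theorem prod_pairRatio_of_geometric (hx : ∀ i, x i ≠ 0) (hinj : Function.Injective x)
    (htail : ∀ k, x (n + k) = t ^ k * x n) (l : ℕ) :
    ∏ i ∈ range (n + l), pairRatio t (x i) (x (n + l)) =
      (∏ i ∈ range n, pairRatio t (x i) (t ^ l * x n)) * ((1 - t) / (1 - t ^ (l + 1))) := by
  have ht0 : t ≠ 0 := left_ne_zero_of_mul (pow_one t ▸ htail 1 ▸ hx (n + 1))
  rw [prod_range_add, ← prod_pairRatio_pow ht0 (pow_ne_one_of_geometric hinj htail)]
  simp only [htail, pairRatio_mul_right (hx n)]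

theorem prod_range_add_div_mul_prod {f : ℕ → K} {c : K} (hc : c ≠ 0) (hf : ∀ i, f i ≠ 0)
    (n k : ℕ) :
    (∏ i ∈ range (n + k), f i / c) * ∏ i ∈ range k, c / f i = ∏ i ∈ range n, f (k + i) / c := by
  rw [add_comm n, prod_range_add, mul_right_comm, ← prod_mul_distrib,
    prod_eq_one fun i _ => by rw [div_mul_div_cancel₀ hc, div_self (hf i)], one_mul]

/-- All column products but those of the first `n` nodes telescope. -/
theorem prod_pairRatio_add_of_geometric (hx : ∀ i, x i ≠ 0) (hinj : Function.Injective x)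
    (htail : ∀ k, x (n + k) = t ^ k * x n) (k : ℕ) :
    (∏ i ∈ range (n + k), (1 - t ^ (i + 1)) / (1 - t)) *
        ∏ j ∈ range (n + k), ∏ i ∈ range j, pairRatio t (x i) (x j) =
      (∏ i ∈ range n, (1 - t ^ (k + i + 1)) / (1 - t)) *
        (∏ i ∈ range n, (x i - x n) / (x i - t ^ k * x n)) *
        ∏ j ∈ range n, ∏ i ∈ range j, pairRatio t (x i) (x j) := by
  have hne (k : ℕ) : 1 - t ^ (k + 1) ≠ 0 :=
    sub_ne_zero.mpr (pow_ne_one_of_geometric hinj htail k).symm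
  have hrow : ∀ i ∈ range n, ∏ l ∈ range k, pairRatio t (x i) (t ^ l * x n) =
      (x i - x n) / (x i - t ^ k * x n) := fun i hi =>
    prod_pairRatio_pow_mul (fun l => htail l ▸ hinj.ne (by simp at hi; omega)) k
  rw [prod_range_add (fun j => ∏ i ∈ range j, pairRatio t (x i) (x j)) n k,
    prod_congr rfl fun l _ => prod_pairRatio_of_geometric hx hinj htail l, prod_mul_distrib,
    Finset.prod_comm, prod_congr rfl hrow,
    ← prod_range_add_div_mul_prod (f := fun i => 1 - t ^ (i + 1)) (by simpa using hne 0) hne]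
  ring

end FiniteSum

section Convergence

theorem exists_valuation_prod_le {K Γ₀ ι : Type*} [Field K] [LinearOrderedCommGroupWithZero Γ₀]
    (v : Valuation K Γ₀) {S : Set ι} {u : ι → K} (hbad : {p ∈ S | 1 < v (u p)}.Finite) :
    ∃ c, ∀ I : Finset ι, ↑I ⊆ S → v (∏ p ∈ I, u p) ≤ v c := by
  classical
  refine ⟨∏ p ∈ hbad.toFinset, u p, fun I hI => ?_⟩
  simp only [map_prod]
  rw [← prod_filter_mul_prod_filter_not I (fun p => 1 < v (u p))]
  refine (mul_le_of_le_one_right' (prod_le_one' fun p hp => ?_)).trans ?_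
  · exact not_lt.mp (mem_filter.mp hp).2
  · refine prod_le_prod_of_subset_of_one_le' (fun p hp => ?_) fun p hp _ => ?_
    · exact hbad.mem_toFinset.mpr ⟨hI (mem_filter.mp hp).1, (mem_filter.mp hp).2⟩
    · exact (hbad.mem_toFinset.mp hp).2.le

variable {K Γ₀ : Type*} [Field K] [LinearOrderedCommGroupWithZero Γ₀] [Valued K Γ₀]

theorem nonarchimedeanRing_of_valued : NonarchimedeanRing K :=
  (Valued.toUniformSpace_eq K Γ₀).symm ▸ (Valued.v (R := K)).subgroups_basis.nonarchimedean

theorem tendsto_zero_of_valuation_le {α : Type*} {l : Filter α} {f g : α → K}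
    (hg : Tendsto g l (𝓝 0)) (hfg : ∀ a, Valued.v (f a) ≤ Valued.v (g a)) :
    Tendsto f l (𝓝 0) := by
  rw [(Valued.hasBasis_nhds_zero K Γ₀).tendsto_right_iff] at hg ⊢
  exact fun γ hγ => (hg γ hγ).mono fun a ha =>
    ((Valuation.restrict_le_iff _).mpr (hfg a)).trans_lt ha

theorem hasSum_of_tendsto_cofinite_zero {ι : Type*} {F : ι → K} {L : K} {s : ℕ → Finset ι}
    (hF : Tendsto F cofinite (𝓝 0)) (hs : Monotone s) (hmem : ∀ i, ∃ k, i ∈ s k)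
    (hL : Tendsto (fun k => ∑ i ∈ s k, F i) atTop (𝓝 L)) : HasSum F L := by
  have : NonarchimedeanRing K := nonarchimedeanRing_of_valued
  rw [HasSum, SummationFilter.unconditional_filter]
  exact tendsto_nhds_of_cauchySeq_of_subseq
    (NonarchimedeanAddGroup.cauchySeq_sum_of_tendsto_cofinite_zero hF)
    (hs.tendsto_atTop_finset hmem) hL

variable {t : K} {x : ℕ → K} {n : ℕ}

theorem tendsto_prod_range_of_geometric (ht : Tendsto (fun k : ℕ => t ^ k) atTop (𝓝 0))
    (hx : ∀ i, x i ≠ 0) :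
    Tendsto (fun k => (∏ i ∈ range n, (1 - t ^ (k + i + 1)) / (1 - t)) *
        ∏ i ∈ range n, (x i - x n) / (x i - t ^ k * x n)) atTop
      (𝓝 ((∏ i ∈ range n, (1 - x n / x i)) / (1 - t) ^ n)) := by
  have hfactor (i : ℕ) : Tendsto (fun k => (1 - t ^ (k + i + 1)) / (1 - t)) atTop
      (𝓝 (1 / (1 - t))) := by
    simpa [add_assoc] using
      ((ht.comp (tendsto_add_atTop_nat (i + 1))).const_sub 1).div_const (1 - t)
  have hnode (i : ℕ) : Tendsto (fun k => (x i - x n) / (x i - t ^ k * x n)) atTop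
      (𝓝 (1 - x n / x i)) := by
    have hden : Tendsto (fun k => x i - t ^ k * x n) atTop (𝓝 (x i)) := by
      simpa using (ht.mul_const (x n)).const_sub (x i)
    rw [← div_self (hx i), ← sub_div]
    exact tendsto_const_nhds.div hden (hx i)
  convert (tendsto_finsetProd (range n) fun i _ => hfactor i).mul
    (tendsto_finsetProd (range n) fun i _ => hnode i) using 2
  rw [prod_const, card_range, one_div, inv_pow, div_eq_inv_mul]

variable [MulArchimedean Γ₀]

theorem tendsto_prod_invSet_zero (ht0 : t ≠ 0) (ht : Valued.v t < 1) {w : ℕ × ℕ → K}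
    (hbad : {p : ℕ × ℕ | p.1 < p.2 ∧ Valued.v t < Valued.v (w p)}.Finite) :
    Tendsto (fun π : {π : Equiv.Perm ℕ // StrictMonoOn π (Set.Ici n)} => ∏ᶠ p ∈ invSet π.1, w p)
      cofinite (𝓝 0) := by
  obtain ⟨c, hc⟩ := exists_valuation_prod_le Valued.v (S := {p : ℕ × ℕ | p.1 < p.2})
    (u := fun p => w p / t) (hbad.subset fun p hp => ⟨hp.1, by
      have := hp.2
      rwa [map_div₀, one_lt_div₀ (zero_lt_iff.mpr (by simpa using ht0))] at this⟩)
  have hpow : Tendsto (fun π : {π : Equiv.Perm ℕ // StrictMonoOn π (Set.Ici n)} =>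
      c * t ^ (invSet π.1).ncard) cofinite (𝓝 0) := by
    simpa using ((Valued.tendsto_zero_pow_of_v_lt_one ht).comp
      (tendsto_ncard_invSet n)).const_mul c
  refine tendsto_zero_of_valuation_le hpow fun π => ?_
  have hfin := finite_invSet π.2
  have hsplit : ∏ᶠ p ∈ invSet π.1, w p =
      (∏ p ∈ hfin.toFinset, w p / t) * t ^ (invSet π.1).ncard := by
    rw [finprod_mem_eq_finite_toFinset_prod _ hfin, Set.ncard_eq_toFinset_card _ hfin,
      ← prod_const, ← prod_mul_distrib]
    simp only [div_mul_cancel₀ _ ht0]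
  rw [hsplit, map_mul, map_mul]
  exact mul_le_mul_left (hc _ fun p hp => (hfin.mem_toFinset.mp hp).1) _

theorem hasSum_straight (ht : Valued.v t < 1) (hx : ∀ i, x i ≠ 0) (hinj : Function.Injective x)
    (hd : ∀ i j, i < j → x i ≠ t * x j) (htail : ∀ k, x (n + k) = t ^ k * x n)
    (hbad : {p : ℕ × ℕ | p.1 < p.2 ∧
      Valued.v t < Valued.v (invWeight t (x p.1) (x p.2))}.Finite) :
    HasSum (fun π : {π // Straight t x π} => ∏ᶠ p ∈ invSet π.1, invWeight t (x p.1) (x p.2))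
      ((∏ i ∈ range n, (1 - x n / x i)) / (1 - t) ^ n *
        ∏ j ∈ range n, ∏ i ∈ range j, pairRatio t (x i) (x j)) := by
  classical
  have ht0 : t ≠ 0 := left_ne_zero_of_mul (pow_one t ▸ htail 1 ▸ hx (n + 1))
  have hmono (π : {π // Straight t x π}) : StrictMonoOn π.1 (Set.Ici n) :=
    π.2.strictMonoOn_of_geometric htail
  have hterms := (tendsto_prod_invSet_zero ht0 ht hbad).comp
    (Function.Injective.tendsto_cofinite (f := fun π : {π // Straight t x π} =>
      (⟨π.1, hmono π⟩ : {π : Equiv.Perm ℕ // StrictMonoOn π (Set.Ici n)}))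
      fun π π' h => Subtype.ext (Subtype.mk.inj h))
  refine hasSum_of_tendsto_cofinite_zero (s := fun k => (permsBelow (n + k)).subtype _) hterms
    (fun k l hkl => subtype_mono (permsBelow_mono (by gcongr)))
    (fun π => ⟨_, mem_subtype.mpr (mem_permsBelow_add_ncard (hmono π))⟩) ?_
  have hsum (k : ℕ) : ∑ π ∈ (permsBelow (n + k)).subtype (Straight t x),
      ∏ᶠ p ∈ invSet π.1, invWeight t (x p.1) (x p.2) =
      (∏ i ∈ range n, (1 - t ^ (k + i + 1)) / (1 - t)) *
        (∏ i ∈ range n, (x i - x n) / (x i - t ^ k * x n)) *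
        ∏ j ∈ range n, ∏ i ∈ range j, pairRatio t (x i) (x j) := by
    have ht1 : t ≠ 1 := fun h => pow_ne_one_of_geometric hinj htail 0 (by rw [h, one_pow])
    rw [← prod_pairRatio_add_of_geometric hx hinj htail, ← sum_permsBelow ht1 hx hinj hd,
      sum_subtype_eq_sum_filter (f := fun π => ∏ᶠ p ∈ invSet π, invWeight t (x p.1) (x p.2))]
    refine sum_filter_of_ne fun π hπ hne => by_contra fun h => hne ?_
    exact finprod_invWeight_eq_zero
      ((finite_toSet _).subset (invSet_subset_of_mem_permsBelow hπ)) h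
  exact ((tendsto_prod_range_of_geometric (Valued.tendsto_zero_pow_of_v_lt_one ht) hx).mul_const
    _).congr fun k => (hsum k).symm

end Convergence

section Rank

variable {α : Type*} {r : α → α → Prop}

/-- The number of elements that the strict total order `r` puts before `a`. -/
noncomputable def rank (r : α → α → Prop) (a : α) : ℕ := {b | r b a}.ncard

theorem rank_eq_rank_add_one [IsStrictTotalOrder α r] {a b : α} (hfin : {c | r c a}.Finite)
    (hab : r a b) (hmid : ∀ c, r a c → ¬ r c b) : rank r b = rank r a + 1 := by
  have hset : {c | r c b} = insert a {c | r c a} := Set.ext fun c => by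
    refine ⟨fun hcb => ?_, ?_⟩
    · rcases trichotomous_of r c a with hca | rfl | hac
      exacts [Or.inr hca, Or.inl rfl, absurd hcb (hmid c hac)]
    · rintro (rfl | hca)
      exacts [hab, _root_.trans hca hab]
  rw [rank, hset, Set.ncard_insert_of_notMem (s := {c | r c a}) (irrefl_of r a) hfin, rank]

variable (hfin : ∀ a, {b | r b a}.Finite)
include hfin

theorem rank_lt_rank [IsStrictOrder α r] {a b : α} (hab : r a b) : rank r a < rank r b :=
  Set.ncard_lt_ncard ⟨fun _ hc => _root_.trans hc hab, fun hs => irrefl_of r a (hs hab)⟩ (hfin b)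

variable [IsStrictTotalOrder α r]

theorem rank_lt_rank_iff {a b : α} : rank r a < rank r b ↔ r a b := by
  refine ⟨fun h => ?_, rank_lt_rank hfin⟩
  rcases trichotomous_of r a b with hab | rfl | hba
  exacts [hab, absurd h (lt_irrefl _), absurd h (rank_lt_rank hfin hba).not_gt]

theorem rank_injective : Function.Injective (rank r) := fun a b h => by
  rcases trichotomous_of r a b with hab | hab | hba
  exacts [absurd h (rank_lt_rank hfin hab).ne, hab, absurd h (rank_lt_rank hfin hba).ne']

theorem exists_rank_eq_of_le {a : α} {k : ℕ} (hk : k ≤ rank r a) : ∃ b, rank r b = k := by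
  rcases hk.eq_or_lt with rfl | hk
  · exact ⟨a, rfl⟩
  have himage : rank r '' {b | r b a} = Set.Iio (rank r a) := by
    refine Set.eq_of_subset_of_ncard_le ?_ ?_ (Set.finite_Iio _)
    · rintro _ ⟨b, hb, rfl⟩
      exact rank_lt_rank hfin hb
    · rw [Set.ncard_image_of_injective _ (rank_injective hfin), ← Nat.card_coe_set_eq]
      simp [rank]
  obtain ⟨b, -, hb⟩ := himage.ge hk
  exact ⟨b, hb⟩

theorem exists_rank_eq [Infinite α] (k : ℕ) : ∃ a, rank r a = k := by
  obtain ⟨_, ⟨a, rfl⟩, hk⟩ :=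
    (Set.infinite_range_of_injective (rank_injective hfin)).exists_gt k
  exact exists_rank_eq_of_le hfin hk.le

/-- The enumeration of an infinite type in the order `r`. -/
noncomputable def rankEquiv [Infinite α] : ℕ ≃ α :=
  (Equiv.ofBijective (rank r) ⟨rank_injective hfin, exists_rank_eq hfin⟩).symm

theorem rank_rankEquiv [Infinite α] (k : ℕ) : rank r (rankEquiv hfin k) = k :=
  (rankEquiv hfin).symm_apply_apply k

theorem rel_rankEquiv_iff [Infinite α] {i j : ℕ} :
    r (rankEquiv hfin i) (rankEquiv hfin j) ↔ i < j := by
  rw [← rank_lt_rank_iff hfin, rank_rankEquiv, rank_rankEquiv]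

theorem eq_rank_of_rel_of_eq_add_one {f : α → ℕ} (hinj : Function.Injective f)
    (hlower : ∀ a, ∀ k < f a, ∃ b, f b = k) (hsucc : ∀ a b, f b = f a + 1 → r a b) (a : α) :
    f a = rank r a := by
  have hlt : ∀ d a b, f b = f a + 1 + d → r a b := by
    intro d
    induction d with
    | zero => exact hsucc
    | succ d ih =>
      intro a b h
      obtain ⟨c, hc⟩ := hlower b (f a + 1) (by omega)
      exact _root_.trans (hsucc a c hc) (ih c b (by omega))
  have hmono : ∀ b, rank r b < rank r a ↔ f b < f a := by
    have hrank : ∀ a b, f a < f b → rank r a < rank r b := fun a b h =>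
      rank_lt_rank hfin (hlt (f b - (f a + 1)) a b (by omega))
    refine fun b => ⟨fun h => ?_, hrank b a⟩
    by_contra! hle
    rcases hle.eq_or_lt with heq | hgt
    · exact h.ne (by rw [hinj heq])
    · exact h.not_gt (hrank a b hgt)
  have himage : f '' {b | r b a} = Set.Iio (f a) := Set.ext fun k => by
    simp only [Set.mem_image, Set.mem_ofPred_eq, ← rank_lt_rank_iff hfin, hmono, Set.mem_Iio]
    refine ⟨fun ⟨_, hb, hbk⟩ => hbk ▸ hb, fun hk => ?_⟩
    obtain ⟨b, rfl⟩ := hlower a k hk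
    exact ⟨b, hk, rfl⟩
  rw [rank, ← Set.ncard_image_of_injective _ hinj, himage, ← Nat.card_coe_set_eq]
  simp

end Rank

section FiniteRank

variable {α : Type*} {r : α → α → Prop} [Finite α] [IsStrictTotalOrder α r] {n : ℕ}

theorem rank_lt_card (hn : Nat.card α = n) (a : α) : rank r a < n :=
  hn ▸ Set.ncard_lt_card fun h => irrefl_of r a (h.symm ▸ Set.mem_univ a : a ∈ {b | r b a})

variable (r) in
/-- The enumeration of a finite type in the order `r`. -/
noncomputable def finRankEquiv (hn : Nat.card α = n) : Fin n ≃ α :=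
  (Equiv.ofBijective (fun a => (⟨rank r a, rank_lt_card hn a⟩ : Fin n))
    ((Nat.bijective_iff_injective_and_card _).mpr
      ⟨fun _ _ h => rank_injective (fun _ => Set.toFinite _) (Fin.mk.inj h), by simpa⟩)).symm

theorem rank_finRankEquiv (hn : Nat.card α = n) (i : Fin n) : rank r (finRankEquiv r hn i) = i :=
  congrArg Fin.val ((finRankEquiv r hn).symm_apply_apply i)

theorem rel_finRankEquiv_iff (hn : Nat.card α = n) {i j : Fin n} :
    r (finRankEquiv r hn i) (finRankEquiv r hn j) ↔ i < j := by
  rw [← rank_lt_rank_iff (r := r) fun _ => Set.toFinite _, rank_finRankEquiv, rank_finRankEquiv,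
    Fin.lt_def]

end FiniteRank

section Compositions

variable {n : ℕ} (c : Composition n)

theorem index_eq_iff_sizeUpTo_le {i j : Fin n} (hij : i ≤ j) :
    c.index i = c.index j ↔ c.sizeUpTo (c.index j) ≤ i := by
  rw [eq_comm, ← c.mem_range_embedding_iff', c.mem_range_embedding_iff]
  exact ⟨fun h => h.1, fun h => ⟨h, lt_of_le_of_lt hij (c.lt_sizeUpTo_index_succ j)⟩⟩

theorem mem_boundaries_iff {b : Fin (n + 1)} :
    b ∈ c.boundaries ↔ ∃ k ≤ c.length, c.sizeUpTo k = b := by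
  rw [Composition.boundaries, Finset.mem_map]
  constructor
  · rintro ⟨k, -, rfl⟩
    exact ⟨k, Nat.lt_succ_iff.mp k.is_lt, rfl⟩
  · rintro ⟨k, hk, h⟩
    exact ⟨⟨k, Nat.lt_succ_iff.mpr hk⟩, mem_univ _, Fin.ext h⟩

theorem index_eq_iff_forall_notMem_boundaries {i j : Fin n} (hij : i ≤ j) :
    c.index i = c.index j ↔ ∀ b : Fin (n + 1), (i : ℕ) < b → (b : ℕ) ≤ j → b ∉ c.boundaries := by
  rw [index_eq_iff_sizeUpTo_le c hij]
  refine ⟨fun h b hib hbj hb => ?_, fun h => ?_⟩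
  · obtain ⟨k, -, hk⟩ := (mem_boundaries_iff c).mp hb
    have hj : (j : ℕ) < c.sizeUpTo ((c.index j : ℕ) + 1) := c.lt_sizeUpTo_index_succ j
    rcases Nat.lt_or_ge (c.index j) k with hlt | hge
    · have := c.monotone_sizeUpTo (show (c.index j : ℕ) + 1 ≤ k from hlt)
      omega
    · have := c.monotone_sizeUpTo hge
      omega
  · by_contra! hlt
    have hle := c.sizeUpTo_index_le j
    exact h ⟨c.sizeUpTo (c.index j), by omega⟩ hlt hle
      ((mem_boundaries_iff c).mpr ⟨c.index j, (c.index j).is_lt.le, rfl⟩)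

theorem prod_index_eq {M : Type*} [CommMonoid M] (f : Fin n → Fin n → M) :
    ∏ j, ∏ i, (if i < j ∧ c.index i = c.index j then f i j else 1) =
      ∏ k, ∏ b, ∏ a ∈ Iio b, f (c.embedding k a) (c.embedding k b) := by
  rw [← c.prod_prod_apply_embedding]
  refine prod_congr rfl fun k _ => prod_congr rfl fun b _ => ?_
  rw [← c.prod_prod_apply_embedding, prod_eq_single k]
  · rw [← filter_gt_eq_Iio, prod_filter]
    simp
  · intro l _ hl
    simp [hl]
  · simp

theorem prod_index_eq_pairRatio {K : Type*} [Field K] {t : K} (ht0 : t ≠ 0)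
    (ht : ∀ k : ℕ, t ^ (k + 1) ≠ 1) :
    ∏ j : Fin n, ∏ i : Fin n,
        (if i < j ∧ c.index i = c.index j then pairRatio t (t ^ (i : ℕ)) (t ^ (j : ℕ)) else 1) =
      (c.blocks.map fun m => ∏ i ∈ Icc 1 m, (1 - t ^ i) / (1 - t)).prod⁻¹ := by
  rw [prod_index_eq c fun i j => pairRatio t (t ^ (i : ℕ)) (t ^ (j : ℕ)), ← c.ofFn_blocksFun,
    List.map_ofFn, List.prod_ofFn, ← prod_inv_distrib]
  refine prod_congr rfl fun k _ => ?_
  rw [Function.comp_apply, ← prod_inv_distrib, ← Finset.Ico_add_one_right_eq_Icc,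
    prod_Ico_eq_prod_range, Nat.add_sub_cancel, prod_range]
  refine prod_congr rfl fun b _ => ?_
  rw [inv_div, add_comm 1, ← prod_pairRatio_pow ht0 ht, ← Nat.Iio_eq_range,
    ← Fin.map_valEmbedding_Iio, prod_map]
  simp only [Fin.valEmbedding_apply]
  refine prod_congr rfl fun a _ => ?_
  rw [c.coe_embedding, c.coe_embedding, pow_add, pow_add, mul_comm, mul_comm _ (t ^ (b : ℕ)),
    pairRatio_mul_right (pow_ne_zero _ ht0)]

end Compositions

section LaurentField

theorem t_ne_zero : t ≠ 0 := by
  rw [t, Ne, HahnSeries.single_eq_zero_iff]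
  exact one_ne_zero

theorem q_ne_zero : q ≠ 0 := by
  rw [q, Ne, map_eq_zero]
  exact RatFunc.X_ne_zero

theorem valuation_t_lt_one : Valued.v t < 1 := by
  rw [t, LaurentSeries.valuation_single_zpow]
  decide

theorem valuation_C_le_one (r : RatFunc ℚ) : Valued.v (HahnSeries.C r : Kqt) ≤ 1 :=
  (LaurentSeries.val_le_one_iff_eq_coe _ _).mpr ⟨PowerSeries.C r, PowerSeries.coe_C r⟩

theorem valuation_q : Valued.v q = 1 := by
  have hinv : (Valued.v q)⁻¹ ≤ 1 := by
    rw [← map_inv₀, q, ← map_inv₀]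
    exact valuation_C_le_one _
  have hpos : 0 < Valued.v q := zero_lt_iff.mpr ((Valuation.ne_zero_iff _).mpr q_ne_zero)
  exact le_antisymm (valuation_C_le_one _) ((inv_le_one₀ hpos).mp hinv)

theorem intDegree_X_pow (k : ℕ) : ((RatFunc.X : RatFunc ℚ) ^ k).intDegree = k := by
  induction k with
  | zero => simp
  | succ k ih =>
    rw [pow_succ, RatFunc.intDegree_mul (pow_ne_zero _ RatFunc.X_ne_zero) RatFunc.X_ne_zero, ih,
      RatFunc.intDegree_X, Nat.cast_succ]

theorem ratFunc_X_zpow_injective :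
    Function.Injective fun d : ℤ => (RatFunc.X : RatFunc ℚ) ^ d := by
  intro d e h
  wlog hde : d ≤ e generalizing d e
  · exact (this h.symm (le_of_not_ge hde)).symm
  obtain ⟨k, rfl⟩ := Int.le.dest hde
  have hX : (RatFunc.X : RatFunc ℚ) ≠ 0 := RatFunc.X_ne_zero
  have hone : (RatFunc.X : RatFunc ℚ) ^ k = 1 := by
    simpa [zpow_add₀ hX, zpow_ne_zero, hX] using h
  have hdeg := intDegree_X_pow k
  rw [hone, RatFunc.intDegree_one] at hdeg
  omega

theorem q_zpow_mul_t_zpow (d c : ℤ) :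
    q ^ d * t ^ c = (HahnSeries.single c (RatFunc.X ^ d) : Kqt) := by
  rw [q, t, ← map_zpow₀, ← RatFunc.single_zpow, HahnSeries.C_apply, HahnSeries.single_mul_single,
    zero_add, mul_one]

theorem q_zpow_mul_t_zpow_inj {d c d' c' : ℤ} :
    q ^ d * t ^ c = q ^ d' * t ^ c' ↔ d = d' ∧ c = c' := by
  refine ⟨fun h => ?_, fun h => by rw [h.1, h.2]⟩
  have hX : ∀ d : ℤ, (RatFunc.X : RatFunc ℚ) ^ d ≠ 0 := fun d => zpow_ne_zero _ RatFunc.X_ne_zero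
  rw [q_zpow_mul_t_zpow, q_zpow_mul_t_zpow] at h
  obtain rfl : c = c' := by
    have := congrArg HahnSeries.orderTop h
    rwa [HahnSeries.orderTop_single (hX d), HahnSeries.orderTop_single (hX d'),
      WithTop.coe_inj] at this
  exact ⟨ratFunc_X_zpow_injective (HahnSeries.single_injective c h), rfl⟩

theorem t_pow_succ_ne_one (k : ℕ) : t ^ (k + 1) ≠ 1 := fun h => by
  have hlt : Valued.v (t ^ (k + 1)) < 1 := by
    rw [map_pow]
    exact pow_lt_one₀ zero_le valuation_t_lt_one k.succ_ne_zero
  rw [h, map_one] at hlt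
  exact hlt.false

theorem valuation_q_zpow_mul_t_zpow_le_one (d : ℤ) {c : ℤ} (hc : 0 ≤ c) :
    Valued.v (q ^ d * t ^ c) ≤ 1 := by
  obtain ⟨k, rfl⟩ := Int.eq_ofNat_of_zero_le hc
  rw [map_mul, map_zpow₀, valuation_q, one_zpow, one_mul, zpow_natCast, map_pow]
  exact pow_le_one' valuation_t_lt_one.le k

theorem valuation_one_sub_le_one (d : ℤ) {c : ℤ} (hc : 0 ≤ c) :
    Valued.v (1 - q ^ d * t ^ c) ≤ 1 :=
  (Valuation.map_sub _ _ _).trans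
    (max_le (map_one _).le (valuation_q_zpow_mul_t_zpow_le_one d hc))

theorem valuation_one_sub_eq_one (d : ℤ) {c : ℤ} (hc : 0 < c) :
    Valued.v (1 - q ^ d * t ^ c) = 1 := by
  refine Valuation.map_one_sub_of_lt _ ?_
  rw [← sub_add_cancel c 1, zpow_add_one₀ t_ne_zero, ← mul_assoc, map_mul]
  exact (mul_le_of_le_one_left' (valuation_q_zpow_mul_t_zpow_le_one d (by omega))).trans_lt
    valuation_t_lt_one

end LaurentField

section Orders

variable {D : Set (ℕ × ℕ)}

instance (T : D → ℕ) : IsStrictTotalOrder D (Precedes T) where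
  irrefl b := by
    unfold Precedes ColBefore
    omega
  trans a b c hab hbc := by
    unfold Precedes ColBefore at *
    omega
  trichotomous b b' h h' := by
    unfold Precedes ColBefore at h h'
    exact Subtype.ext (Prod.ext (by omega) (by omega))

/-- The order of the boxes in which `Min(T)` numbers them: smaller values of `T` come first, ties
are broken row by row from top to bottom, left to right within a row. -/
def RowBefore (T : D → ℕ) (b b' : D) : Prop :=
  T b < T b' ∨ (T b = T b' ∧ (b.1.1 < b'.1.1 ∨ (b.1.1 = b'.1.1 ∧ b.1.2 < b'.1.2)))

instance (T : D → ℕ) : IsStrictTotalOrder D (RowBefore T) where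
  irrefl b := by
    unfold RowBefore
    omega
  trans a b c hab hbc := by
    unfold RowBefore at *
    omega
  trichotomous b b' h h' := by
    unfold RowBefore at h h'
    exact Subtype.ext (Prod.ext (by omega) (by omega))

theorem stdLabel_lt_iff {T : D → ℕ} (hfin : ∀ b, {b' | Precedes T b' b}.Finite) {b b' : D} :
    stdLabel T b < stdLabel T b' ↔ Precedes T b b' :=
  (Nat.add_lt_add_iff_right ..).trans (rank_lt_rank_iff hfin)

end Orders

section ColStrict

variable {D : Set (ℕ × ℕ)} {T : D → ℕ}

/-- `D` is a diagram, and `T` is weakly decreasing along its rows and strictly decreasing along its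
columns: the condition shared by the elements of `Ω(λ)` and their restrictions to `λ^{(n)}`. -/
structure IsColStrict (T : D → ℕ) : Prop where
  lower : IsLowerSet D
  row_weak : ∀ b b' : D, b.1.1 = b'.1.1 → b.1.2 < b'.1.2 → T b' ≤ T b
  col_strict : ∀ b b' : D, b.1.2 = b'.1.2 → b.1.1 < b'.1.1 → T b' < T b

/-- `b'` is the right neighbour of `b`, and `T` takes the same value on both. -/
def RightNext (T : D → ℕ) (b b' : D) : Prop :=
  b'.1 = (b.1.1, b.1.2 + 1) ∧ T b = T b'

namespace IsColStrict

variable (hT : IsColStrict T) {b b' : D}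
include hT

theorem row_le (h : T b = T b') (hc : b.1.2 < b'.1.2) : b'.1.1 ≤ b.1.1 := by
  by_contra! hr
  have hmem : (b.1.1, b'.1.2) ∈ D :=
    hT.lower (show (b.1.1, b'.1.2) ≤ b'.1 from ⟨hr.le, le_rfl⟩) b'.2
  have hrow := hT.row_weak b ⟨_, hmem⟩ rfl hc
  have hcol := hT.col_strict ⟨_, hmem⟩ b' rfl hr
  omega

theorem eq_of_col_eq (h : T b = T b') (hc : b.1.2 = b'.1.2) : b = b' := by
  rcases lt_trichotomy b.1.1 b'.1.1 with hr | hr | hr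
  · exact absurd h (hT.col_strict b b' hc hr).ne'
  · exact Subtype.ext (Prod.ext hr hc)
  · exact absurd h (hT.col_strict b' b hc.symm hr).ne

theorem precedes_iff_col_lt (h : T b = T b') : Precedes T b b' ↔ b.1.2 < b'.1.2 := by
  refine ⟨?_, fun hc => Or.inr ⟨h, Or.inl hc⟩⟩
  rintro (hlt | ⟨-, hc | ⟨hc, hr⟩⟩)
  · exact absurd h hlt.ne'
  · exact hc
  · rw [hT.eq_of_col_eq h hc] at hr
    exact absurd hr (lt_irrefl _)

theorem content_lt (h : T b = T b') (hc : b.1.2 < b'.1.2) : content b.1 < content b'.1 := by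
  have := hT.row_le h hc
  unfold content
  omega

theorem content_add_one_lt (h : T b = T b') (hc : b.1.2 < b'.1.2) (hr : b.1.1 ≠ b'.1.1) :
    content b.1 + 1 < content b'.1 := by
  have := hT.row_le h hc
  unfold content
  omega

theorem eq_of_content_eq (h : T b = T b') (hc : content b.1 = content b'.1) : b = b' := by
  rcases lt_trichotomy b.1.2 b'.1.2 with hlt | heq | hgt
  · exact absurd hc (hT.content_lt h hlt).ne
  · exact hT.eq_of_col_eq h heq
  · exact absurd hc (hT.content_lt h.symm hgt).ne'

theorem rightNext_iff : RightNext T b b' ↔ T b = T b' ∧ content b'.1 = content b.1 + 1 := by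
  constructor
  · rintro ⟨hb, h⟩
    refine ⟨h, ?_⟩
    rw [content, content, hb]
    push_cast
    ring
  · rintro ⟨h, hc⟩
    have hcol : b.1.2 < b'.1.2 := by
      by_contra! hle
      rcases hle.eq_or_lt with heq | hlt
      · rw [hT.eq_of_col_eq h heq.symm] at hc
        omega
      · have := hT.content_lt h.symm hlt
        omega
    have hrow : b.1.1 = b'.1.1 := by
      by_contra hr
      have := hT.content_add_one_lt h hcol hr
      omega
    refine ⟨Prod.ext hrow.symm ?_, h⟩
    unfold content at hc
    omega

theorem transGen_rightNext (h : T b = T b') (hr : b.1.1 = b'.1.1) (hc : b.1.2 < b'.1.2) :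
    Relation.TransGen (RightNext T) b b' := by
  obtain ⟨d, hd⟩ := Nat.exists_eq_add_of_lt hc
  induction d generalizing b with
  | zero => exact .single ⟨Prod.ext hr.symm hd, h⟩
  | succ d ih =>
    have hmem : (b.1.1, b.1.2 + 1) ∈ D :=
      hT.lower (show (b.1.1, b.1.2 + 1) ≤ b'.1 from ⟨hr.le, hc⟩) b'.2
    set c : D := ⟨_, hmem⟩ with hcdef
    have hbc : T b = T c := by
      have hle := hT.row_weak b c rfl (Nat.lt_succ_self _)
      have hge := hT.row_weak c b' hr (by simp only [hcdef]; omega)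
      omega
    exact .head ⟨rfl, hbc⟩ (ih (b := c) (hbc.symm.trans h) hr (by simp only [hcdef]; omega)
      (by simp only [hcdef]; omega))

end IsColStrict

end ColStrict

section Padding

variable {lam : YoungDiagram}

theorem col_lt_rowLen_zero {i j : ℕ} (h : (i, j) ∈ lam) : j < lam.rowLen 0 :=
  YoungDiagram.mem_iff_lt_rowLen.mp (lam.up_left_mem i.zero_le le_rfl h)

theorem mem_pad_iff {n : ℕ} {b : ℕ × ℕ} : b ∈ boxes (pad lam n) ↔
    (b.1 = 0 ∨ (b.1 - 1, b.2) ∈ lam) ∧ b.2 < max (n - lam.card) (lam.rowLen 0) := by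
  obtain ⟨i, j⟩ := b
  simp only [boxes, pad, coe_union, Set.mem_union, mem_coe, mem_product, mem_singleton,
    Finset.mem_range, Finset.mem_image, Prod.mk.injEq, YoungDiagram.mem_cells, Prod.exists]
  constructor
  · rintro (⟨rfl, hj⟩ | ⟨i, j, hij, rfl, rfl⟩)
    · exact ⟨Or.inl rfl, hj⟩
    · exact ⟨Or.inr hij, lt_max_of_lt_right (col_lt_rowLen_zero hij)⟩
  · rintro ⟨hi, hj⟩
    rcases Nat.eq_zero_or_pos i with h0 | h0
    · exact Or.inl ⟨h0, hj⟩
    · exact Or.inr ⟨i - 1, j, hi.resolve_left h0.ne', by omega, rfl⟩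

theorem mem_padInf_iff {b : ℕ × ℕ} : b ∈ padInf lam ↔ b.1 = 0 ∨ (b.1 - 1, b.2) ∈ lam := by
  simp only [padInf, Set.mem_iUnion, exists_prop, mem_pad_iff]
  exact ⟨fun ⟨_, _, hb, _⟩ => hb, fun hb => ⟨nMin lam + b.2 + 1, by omega, hb,
    lt_max_of_lt_left (by unfold nMin; omega)⟩⟩

theorem mem_pad_iff_mem_padInf {n : ℕ} (hn : nMin lam ≤ n) {b : ℕ × ℕ} :
    b ∈ boxes (pad lam n) ↔ b ∈ padInf lam ∧ b.2 < n - lam.card := by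
  rw [mem_pad_iff, mem_padInf_iff, max_eq_left (by unfold nMin at hn; omega)]

theorem isLowerSet_padInf : IsLowerSet (padInf lam) :=
  isLowerSet_iUnion₂ fun n _ => (pad lam n).isLowerSet

theorem card_pad {n : ℕ} (hn : nMin lam ≤ n) : (pad lam n).card = n := by
  unfold nMin at hn
  have hdisj : Disjoint ({0} ×ˢ Finset.range (max (n - lam.card) (lam.rowLen 0)))
      (lam.cells.image fun b => (b.1 + 1, b.2)) := by
    simp only [disjoint_left, mem_product, mem_singleton, Finset.mem_image, not_exists, not_and]
    rintro b ⟨h0, -⟩ c - rfl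
    exact absurd h0 c.1.succ_ne_zero
  have hinj : Function.Injective fun b : ℕ × ℕ => (b.1 + 1, b.2) := fun b c h => by
    simpa [Prod.ext_iff] using h
  rw [YoungDiagram.card, pad, card_union_of_disjoint hdisj, card_product, card_singleton,
    card_range, card_image_of_injective _ hinj, max_eq_left (by omega), one_mul]
  exact Nat.sub_add_cancel (by omega)

instance infinite_padInf : Infinite (padInf lam) :=
  Infinite.of_injective (fun k : ℕ => (⟨(0, k), mem_padInf_iff.mpr (Or.inl rfl)⟩ : padInf lam))
    fun k l h => by simpa using h

theorem finite_col_lt (k : ℕ) : {b : padInf lam | b.1.2 < k}.Finite := by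
  refine ((pad lam (nMin lam + k)).cells.finite_toSet.preimage
    Subtype.val_injective.injOn).subset fun b hb => ?_
  refine (mem_pad_iff_mem_padInf (by omega)).mpr ⟨b.2, ?_⟩
  have : b.1.2 < k := hb
  unfold nMin
  omega

theorem finite_content_le (c : ℤ) : {b : padInf lam | content b.1 ≤ c}.Finite := by
  refine (finite_col_lt (c.toNat + 1 + lam.rowLen 0)).subset fun b hb => ?_
  change content b.1 ≤ c at hb
  change b.1.2 < c.toNat + 1 + lam.rowLen 0
  rcases mem_padInf_iff.mp b.2 with hrow | hmem
  · unfold content at hb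
    omega
  · exact (col_lt_rowLen_zero hmem).trans_le (Nat.le_add_left _ _)

end Padding

namespace Omega

variable {lam : YoungDiagram} (T : Omega lam)

theorem isColStrict : IsColStrict T.val := ⟨isLowerSet_padInf, T.row_weak, T.col_strict⟩

theorem isColStrict_restrict (n : ℕ) : IsColStrict (T.restrict n) :=
  ⟨(pad lam n).isLowerSet, fun _ _ hr hc => T.row_weak _ _ hr hc,
    fun _ _ hc hr => T.col_strict _ _ hc hr⟩

theorem rk_spec : nMin lam ≤ T.rk ∧
    ∀ b : padInf lam, b.1 ∉ boxes (pad lam T.rk) → T.val b = 0 := by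
  refine Nat.sInf_mem (s := {n | nMin lam ≤ n ∧
    ∀ b : padInf lam, b.1 ∉ boxes (pad lam n) → T.val b = 0}) ?_
  obtain ⟨m, hm⟩ := (T.finite_support.image fun b => b.1.2).bddAbove
  refine ⟨nMin lam + m + 1, by omega, fun b => ?_⟩
  rw [not_imp_comm, mem_pad_iff_mem_padInf (by omega)]
  intro hb
  have : b.1.2 ≤ m := hm ⟨b, hb, rfl⟩
  refine ⟨b.2, ?_⟩
  unfold nMin
  omega

theorem finite_precedes (b : padInf lam) : {b' | Precedes T.val b' b}.Finite := by
  refine (T.finite_support.union (finite_col_lt (b.1.2 + 1))).subset fun b' hb' => ?_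
  change Precedes T.val b' b at hb'
  change T.val b' ≠ 0 ∨ b'.1.2 < b.1.2 + 1
  unfold Precedes ColBefore at hb'
  omega

/-- The boxes of `λ^{(∞)}` in the order defined by `T`. -/
noncomputable def box : ℕ ≃ padInf lam := rankEquiv T.finite_precedes

theorem precedes_box_iff {i j : ℕ} : Precedes T.val (T.box i) (T.box j) ↔ i < j :=
  rel_rankEquiv_iff T.finite_precedes

theorem precedes_iff_mem_pad {n : ℕ} (hn : T.rk ≤ n) {b b' : padInf lam}
    (hb : b.1 = (0, n - lam.card)) : Precedes T.val b' b ↔ b'.1 ∈ boxes (pad lam n) := by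
  obtain ⟨hrk, hvanish⟩ := T.rk_spec
  have hzero : ∀ c : padInf lam, T.rk - lam.card ≤ c.1.2 → T.val c = 0 := fun c hc =>
    hvanish c fun h => ((mem_pad_iff_mem_padInf hrk).mp h).2.not_ge hc
  have hcol : b.1.2 = n - lam.card := congrArg Prod.snd hb
  have hTb := hzero b (by omega)
  have hTb' := hzero b'
  have hrow : b.1.1 = 0 := congrArg Prod.fst hb
  rw [mem_pad_iff_mem_padInf (hrk.trans hn), Precedes, ColBefore, and_iff_right b'.2]
  omega

theorem box_eq {n : ℕ} (hn : T.rk ≤ n) : (T.box n).1 = (0, n - lam.card) := by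
  set b : padInf lam := ⟨(0, n - lam.card), mem_padInf_iff.mpr (Or.inl rfl)⟩
  have hrank : rank (Precedes T.val) b = n := by
    have hset : {b' | Precedes T.val b' b} = Subtype.val ⁻¹' boxes (pad lam n) :=
      Set.ext fun b' => T.precedes_iff_mem_pad hn rfl
    rw [rank, hset, Set.ncard_preimage_of_injective_subset_range Subtype.val_injective
      (Subtype.range_coe ▸ pad_subset_padInf lam n), boxes, Set.ncard_coe_finset]
    exact card_pad (T.rk_spec.1.trans hn)
  exact congrArg Subtype.val
    (rank_injective T.finite_precedes ((rank_rankEquiv T.finite_precedes n).trans hrank.symm))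

theorem box_mem_pad_iff (i : ℕ) : (T.box i).1 ∈ boxes (pad lam T.rk) ↔ i < T.rk := by
  rw [← T.precedes_iff_mem_pad le_rfl (T.box_eq le_rfl), precedes_box_iff]

end Omega

section Nodes

variable {D : Set (ℕ × ℕ)} {T : D → ℕ}

/-- The monomial `q^{T(b)} t^{c(b)}`. The factors of both sides of the identity are functions of
the ratios of these monomials. -/
noncomputable def node (T : D → ℕ) (b : D) : Kqt := q ^ (T b : ℤ) * t ^ content b.1

theorem node_ne_zero (b : D) : node T b ≠ 0 :=
  mul_ne_zero (zpow_ne_zero _ q_ne_zero) (zpow_ne_zero _ t_ne_zero)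

theorem pairFactor_eq_one_sub_div (p : D × D) (k : ℤ) :
    pairFactor T p k = 1 - node T p.2 * t ^ k / node T p.1 := by
  rw [pairFactor, node, node, zpow_sub₀ q_ne_zero, zpow_add₀ t_ne_zero, zpow_sub₀ t_ne_zero]
  ring

theorem pairFactor_zero_div_one (p : D × D) :
    pairFactor T p 0 / pairFactor T p 1 = pairRatio t (node T p.1) (node T p.2) := by
  have hne := node_ne_zero (T := T) p.1
  rw [pairFactor_eq_one_sub_div, pairFactor_eq_one_sub_div, zpow_zero, zpow_one, mul_one,
    one_sub_div hne, one_sub_div hne, div_div_div_cancel_right₀ hne, pairRatio, mul_comm t]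

theorem t_mul_pairFactor_neg_one_div_one (p : D × D) :
    t * (pairFactor T p (-1) / pairFactor T p 1) = invWeight t (node T p.1) (node T p.2) := by
  have hne := node_ne_zero (T := T) p.1
  have ht := t_ne_zero
  rw [pairFactor_eq_one_sub_div, pairFactor_eq_one_sub_div, zpow_neg_one, zpow_one,
    one_sub_div hne, one_sub_div hne, div_div_div_cancel_right₀ hne, invWeight,
    mul_comm t (node T p.2), ← mul_div_assoc]
  congr 1
  field_simp

theorem node_injective (hT : IsColStrict T) : Function.Injective (node T) := fun b b' h => by
  rw [node, node, q_zpow_mul_t_zpow_inj, Nat.cast_inj] at h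
  exact hT.eq_of_content_eq h.1 h.2

theorem node_eq_t_mul_iff (hT : IsColStrict T) {b b' : D} :
    node T b' = t * node T b ↔ RightNext T b b' := by
  rw [hT.rightNext_iff, node, node, mul_left_comm, mul_comm t, ← zpow_add_one₀ t_ne_zero,
    q_zpow_mul_t_zpow_inj, Nat.cast_inj, eq_comm (a := T b')]

theorem node_ne_t_mul (hT : IsColStrict T) {b b' : D} (h : Precedes T b b') :
    node T b ≠ t * node T b' := fun heq => by
  obtain ⟨hcol, hTb⟩ := (node_eq_t_mul_iff hT).mp heq
  have hlt := (hT.precedes_iff_col_lt hTb.symm).mp h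
  rw [hcol] at hlt
  omega

theorem valuation_invWeight_le {b b' : D} (h : content b.1 < content b'.1) :
    Valued.v (invWeight t (node T b) (node T b')) ≤ Valued.v t := by
  have hden :=
    valuation_one_sub_eq_one (T b' - T b) (c := content b'.1 - content b.1 + 1) (by omega)
  rw [← t_mul_pairFactor_neg_one_div_one (b, b'), pairFactor, pairFactor, map_mul, map_div₀, hden,
    div_one]
  exact mul_le_of_le_one_right' (valuation_one_sub_le_one _ (by dsimp only; omega))

end Nodes

section Series

variable {lam : YoungDiagram}

namespace Omega

variable (T : Omega lam)

/-- The nodes of the boxes of `λ^{(∞)}`, in the order defined by `T`. -/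
noncomputable def nodes (i : ℕ) : Kqt := node T.val (T.box i)

theorem nodes_eq {n : ℕ} (hn : T.rk ≤ n) : T.nodes n = t ^ ((n : ℤ) - (lam.card : ℤ)) := by
  have hval : T.val (T.box n) = 0 :=
    T.rk_spec.2 _ fun h => ((T.box_mem_pad_iff n).mp h).not_ge hn
  have hcard : lam.card ≤ T.rk := le_trans (Nat.le_add_right _ _) T.rk_spec.1
  rw [nodes, node, hval, T.box_eq hn, content, Nat.cast_sub (hcard.trans hn), Nat.cast_zero,
    zpow_zero, one_mul, sub_zero]

theorem nodes_tail (k : ℕ) : T.nodes (T.rk + k) = t ^ k * T.nodes T.rk := by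
  rw [T.nodes_eq le_rfl, T.nodes_eq (Nat.le_add_right _ _), ← zpow_natCast,
    ← zpow_add₀ t_ne_zero]
  congr 1
  push_cast
  ring

theorem finite_bad_pairs : {p : ℕ × ℕ | p.1 < p.2 ∧
    Valued.v t < Valued.v (invWeight t (T.nodes p.1) (T.nodes p.2))}.Finite := by
  have hfin : (⋃ b ∈ {b | T.val b ≠ 0}, Prod.mk b ''
      {b' : padInf lam | content b'.1 ≤ content b.1}).Finite :=
    T.finite_support.biUnion fun b _ => (finite_content_le _).image _
  refine (hfin.preimage (f := T.box.prodCongr T.box) (Equiv.injective _).injOn).subset ?_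
  rintro ⟨i, j⟩ ⟨hij, hv⟩
  have hle : content (T.box j).1 ≤ content (T.box i).1 := by
    by_contra! hlt
    exact hv.not_ge (valuation_invWeight_le hlt)
  refine Set.mem_biUnion (x := T.box i) (fun h0 => ?_) ⟨T.box j, hle, rfl⟩
  have hprec : Precedes T.val (T.box i) (T.box j) := T.precedes_box_iff.mpr hij
  have heq : T.val (T.box i) = T.val (T.box j) := by
    unfold Precedes at hprec
    omega
  exact hle.not_gt
    (T.isColStrict.content_lt heq ((T.isColStrict.precedes_iff_col_lt heq).mp hprec))

end Omega

namespace APSYTOver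

variable {T : Omega lam} (τ : APSYTOver T)

/-- The permutation of `ℕ` that describes `τ`: it takes the position of a box in the order defined
by `T` to its number in `τ`, where both are counted from `0`. -/
noncomputable def perm : Equiv.Perm ℕ :=
  Equiv.ofBijective (fun i => (τ.1.label (T.box i)).idx - 1) <| by
    refine ⟨fun i j h => ?_, fun k => ?_⟩
    · have hi := τ.1.idx_pos (T.box i)
      have hj := τ.1.idx_pos (T.box j)
      obtain ⟨b, -, hb⟩ := τ.1.existsUnique_idx _ hi
      exact T.box.injective ((hb _ rfl).trans (hb _ (by simp only at h; omega)).symm)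
    · obtain ⟨b, hb, -⟩ := τ.1.existsUnique_idx (k + 1) (by omega)
      exact ⟨T.box.symm b, by simp [hb]⟩

theorem idx_eq_perm_add_one (i : ℕ) : (τ.1.label (T.box i)).idx = τ.perm i + 1 :=
  (Nat.sub_add_cancel (τ.1.idx_pos (T.box i))).symm

theorem exp_eq (b : padInf lam) : (τ.1.label b).exp = T.val b := congrFun τ.2 b

theorem straight_perm : Straight t T.nodes τ.perm := fun i j _ h => by
  obtain ⟨hb, hval⟩ := (node_eq_t_mul_iff T.isColStrict).mp h
  rcases τ.1.strict.1 (T.box i) (T.box j) (by rw [hb]) (by rw [hb]; exact Nat.lt_succ_self _)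
    with hlt | ⟨-, hlt⟩
  · rw [τ.exp_eq, τ.exp_eq] at hlt
    exact absurd hval hlt.ne'
  · rw [τ.idx_eq_perm_add_one, τ.idx_eq_perm_add_one] at hlt
    exact Nat.lt_of_succ_lt_succ hlt

theorem perm_injective : Function.Injective (perm (T := T)) := fun τ τ' h => by
  have hlabel : τ.1.label = τ'.1.label := by
    refine T.box.surjective.injective_comp_right (funext fun i => ?_)
    ext
    · simp only [Function.comp_apply, idx_eq_perm_add_one, h]
    · simp only [Function.comp_apply, exp_eq]
  obtain ⟨⟨l, _, _, _, _⟩, _⟩ := τ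
  obtain ⟨⟨l', _, _, _, _⟩, _⟩ := τ'
  subst hlabel
  rfl

end APSYTOver

variable (T : Omega lam)

theorem Straight.lt_of_rightNext {T : Omega lam} {π : Equiv.Perm ℕ} (hπ : Straight t T.nodes π)
    {b b' : padInf lam} (h : RightNext T.val b b') : π (T.box.symm b) < π (T.box.symm b') := by
  refine hπ _ _ ?_ ?_
  · rw [← T.precedes_box_iff, Equiv.apply_symm_apply, Equiv.apply_symm_apply,
      T.isColStrict.precedes_iff_col_lt h.2, h.1]
    exact Nat.lt_succ_self _
  · rw [Omega.nodes, Omega.nodes, Equiv.apply_symm_apply, Equiv.apply_symm_apply]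
    exact (node_eq_t_mul_iff T.isColStrict).mpr h

/-- The tableau over `T` described by a straight permutation. -/
noncomputable def ofStraight (π : Equiv.Perm ℕ) (hπ : Straight t T.nodes π) : APSYTOver T where
  val :=
    { label := fun b => ⟨π (T.box.symm b) + 1, T.val b⟩
      idx_pos := fun b => Nat.succ_pos _
      strict := by
        refine ⟨fun b b' hr hc => ?_, fun b b' hc hr => Or.inl (T.col_strict b b' hc hr)⟩
        rcases (T.row_weak b b' hr hc).lt_or_eq with hlt | heq
        · exact Or.inl hlt
        · exact Or.inr ⟨heq.symm, Nat.succ_lt_succ <| Relation.TransGen.trans_induction_on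
            (motive := fun {c c'} _ => π (T.box.symm c) < π (T.box.symm c'))
            (T.isColStrict.transGen_rightNext heq.symm hr hc) hπ.lt_of_rightNext
            fun _ _ => lt_trans⟩
      finite_exp := T.finite_support.subset fun _ => Nat.ne_of_gt
      existsUnique_idx := fun i hi => by
        refine ⟨T.box (π.symm (i - 1)), by simp; omega, fun b hb => ?_⟩
        rw [← Equiv.symm_apply_eq, Equiv.eq_symm_apply]
        exact Nat.eq_sub_of_add_eq hb }
  property := rfl

/-- The correspondence between the tableaux over `T` and the straight permutations. -/
noncomputable def straightEquiv : APSYTOver T ≃ {π // Straight t T.nodes π} :=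
  Equiv.ofBijective (fun τ => ⟨τ.perm, τ.straight_perm⟩)
    ⟨fun _ _ h => APSYTOver.perm_injective (congrArg Subtype.val h), fun π =>
      ⟨ofStraight T π.1 π.2, Subtype.ext <| Equiv.ext fun i =>
        congrArg π.1 (T.box.symm_apply_apply i)⟩⟩

namespace APSYTOver

variable {T} (τ : APSYTOver T)

theorem finite_invSet_perm : (invSet τ.perm).Finite :=
  finite_invSet (τ.straight_perm.strictMonoOn_of_geometric T.nodes_tail)

theorem bijOn_Inv : Set.BijOn (T.box.prodCongr T.box) (invSet τ.perm) (Inv τ.1.label) := by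
  have hpreimage : invSet τ.perm = T.box.prodCongr T.box ⁻¹' Inv τ.1.label := by
    ext ⟨i, j⟩
    have hexp : expo τ.1.label = T.val := τ.2
    change i < j ∧ τ.perm j < τ.perm i ↔ stdLabel (expo τ.1.label) (T.box i) <
      stdLabel (expo τ.1.label) (T.box j) ∧ (τ.1.label (T.box j)).idx < (τ.1.label (T.box i)).idx
    rw [hexp, stdLabel_lt_iff T.finite_precedes, T.precedes_box_iff, τ.idx_eq_perm_add_one,
      τ.idx_eq_perm_add_one, Nat.add_lt_add_iff_right]
  rw [hpreimage]
  exact (Equiv.bijective _).bijOn_preimage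

theorem finite_Inv : (Inv τ.1.label).Finite :=
  τ.bijOn_Inv.image_eq ▸ τ.finite_invSet_perm.image _

end APSYTOver

theorem seriesTerm_eq (τ : APSYTOver T) :
    seriesTerm T τ = ∏ᶠ p ∈ invSet τ.perm, invWeight t (T.nodes p.1) (T.nodes p.2) := by
  have hfin := τ.finite_invSet_perm
  have hcard : (Inv τ.1.label).ncard = #hfin.toFinset := by
    rw [← τ.bijOn_Inv.image_eq, Set.ncard_image_of_injective _ (Equiv.injective _),
      Set.ncard_eq_toFinset_card _ hfin]
  rw [seriesTerm, hcard, ← finprod_mem_eq_of_bijOn _ τ.bijOn_Inv (fun p _ => rfl),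
    finprod_mem_eq_finite_toFinset_prod _ hfin, finprod_mem_eq_finite_toFinset_prod _ hfin,
    ← prod_const, ← prod_mul_distrib]
  exact prod_congr rfl fun p _ => t_mul_pairFactor_neg_one_div_one _

theorem hasSum_seriesTerm : HasSum (seriesTerm T)
    ((∏ i ∈ range T.rk, (1 - T.nodes T.rk / T.nodes i)) / (1 - t) ^ T.rk *
      ∏ j ∈ range T.rk, ∏ i ∈ range j, pairRatio t (T.nodes i) (T.nodes j)) := by
  have h := hasSum_straight (x := T.nodes) valuation_t_lt_one
    (fun i => node_ne_zero (T.box i))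
    ((node_injective T.isColStrict).comp T.box.injective)
    (fun i j hij => node_ne_t_mul T.isColStrict (T.precedes_box_iff.mpr hij)) T.nodes_tail
    T.finite_bad_pairs
  rw [← (straightEquiv T).hasSum_iff] at h
  exact (funext (seriesTerm_eq T) : seriesTerm T = _) ▸ h

end Series

section SwapLabel

variable {D : Set (ℕ × ℕ)} (i : ℕ) (f : D → PLabel)

theorem swapLabel_idx (b : D) : (swapLabel i f b).idx = Equiv.swap i (i + 1) (f b).idx := by
  unfold swapLabel
  rw [Equiv.swap_apply_def]
  split_ifs <;> rfl

theorem swapLabel_exp (b : D) : (swapLabel i f b).exp = (f b).exp := by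
  unfold swapLabel
  split_ifs <;> rfl

theorem swapLabel_swapLabel : swapLabel i (swapLabel i f) = f := by
  funext b
  ext
  · rw [swapLabel_idx, swapLabel_idx, Equiv.swap_apply_self]
  · rw [swapLabel_exp, swapLabel_exp]

theorem swap_apply_mem {s : Finset ℕ} {i j k : ℕ} (hi : i ∈ s) (hj : j ∈ s) (hk : k ∈ s) :
    Equiv.swap i j k ∈ s := by
  rw [Equiv.swap_apply_def]
  split_ifs <;> assumption

theorem swap_succ_lt_swap_succ {i x y : ℕ} (h : x < y) (hne : ¬ (x = i ∧ y = i + 1)) :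
    Equiv.swap i (i + 1) x < Equiv.swap i (i + 1) y := by
  rw [Equiv.swap_apply_def, Equiv.swap_apply_def]
  split_ifs <;> omega

theorem lt_of_swap_succ_lt_swap_succ {i x y : ℕ}
    (h : Equiv.swap i (i + 1) x < Equiv.swap i (i + 1) y) (hne : ¬ (x = i + 1 ∧ y = i)) :
    x < y := by
  rw [Equiv.swap_apply_def, Equiv.swap_apply_def] at h
  split_ifs at h <;> omega

variable {i f}

theorem swapLabel_lt_swapLabel {b b' : D} (h : f b < f b')
    (hne : (f b).exp = (f b').exp → ¬ ((f b).idx = i ∧ (f b').idx = i + 1)) :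
    swapLabel i f b < swapLabel i f b' := by
  rcases h with hexp | ⟨hexp, hidx⟩
  · left
    rwa [swapLabel_exp, swapLabel_exp]
  · right
    rw [swapLabel_exp, swapLabel_exp, swapLabel_idx, swapLabel_idx]
    exact ⟨hexp, swap_succ_lt_swap_succ hidx (hne hexp)⟩

end SwapLabel

section MinTableau

variable {μ : YoungDiagram} {T : boxes μ → ℕ}

theorem card_boxes (μ : YoungDiagram) : Nat.card (boxes μ) = μ.card :=
  Nat.card_eq_fintype_card.trans (Fintype.card_coe μ.cells)

theorem IsColStrict.col_lt_of_row_lt (hT : IsColStrict T) {b b' : boxes μ} (h : T b = T b')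
    (hr : b'.1.1 < b.1.1) : b.1.2 < b'.1.2 := by
  rcases lt_trichotomy b.1.2 b'.1.2 with hc | hc | hc
  · exact hc
  · rw [hT.eq_of_col_eq h hc] at hr
    exact absurd hr (lt_irrefl _)
  · exact absurd (hT.row_le h.symm hc) hr.not_ge

/-- The tableau `Min(T)`: over `T`, with numbers increasing in the order `RowBefore T`. -/
noncomputable def minTableau (hT : IsColStrict T) : PSYT μ where
  label b := ⟨rank (RowBefore T) b + 1, T b⟩
  idx_mem b := mem_Icc.mpr ⟨Nat.le_add_left _ _, rank_lt_card (card_boxes μ) b⟩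
  existsUnique_idx j hj := by
    obtain ⟨k, rfl⟩ := Nat.exists_eq_add_of_le' (mem_Icc.mp hj).1
    refine ⟨finRankEquiv (RowBefore T) (card_boxes μ) ⟨k, (mem_Icc.mp hj).2⟩,
      congrArg (· + 1) (rank_finRankEquiv ..), fun b hb => ?_⟩
    refine rank_injective (r := RowBefore T) (fun _ => Set.toFinite _) ?_
    exact (Nat.succ.inj hb).trans (rank_finRankEquiv (card_boxes μ) ⟨k, _⟩).symm
  strict := by
    refine ⟨fun b b' hr hc => ?_, fun b b' hc hr => Or.inl (hT.col_strict b b' hc hr)⟩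
    rcases (hT.row_weak b b' hr hc).lt_or_eq with hlt | heq
    · exact Or.inl hlt
    · exact Or.inr ⟨heq.symm, Nat.succ_lt_succ (rank_lt_rank (fun _ => Set.toFinite _)
        (Or.inr ⟨heq.symm, Or.inr ⟨hr, hc⟩⟩))⟩

namespace PSYT

theorem ext_label {τ τ' : PSYT μ} (h : τ.label = τ'.label) : τ = τ' := by
  cases τ
  cases τ'
  congr

variable (τ : PSYT μ)

theorem idx_injective : Function.Injective fun b => (τ.label b).idx := fun b b' h => by
  obtain ⟨c, -, hc⟩ := τ.existsUnique_idx _ (τ.idx_mem b)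
  exact (hc b rfl).trans (hc b' h.symm).symm

/-- The tableau `s_i(τ)`, for boxes `b`, `b'` with numbers `i`, `i + 1` such that the exchange
does not violate strictness. -/
def swap (b b' : boxes μ) (hb : (τ.label b').idx = (τ.label b).idx + 1)
    (hbb : (τ.label b).exp = (τ.label b').exp → b.1.1 ≠ b'.1.1 ∧ b.1.2 ≠ b'.1.2) : PSYT μ where
  label := swapLabel (τ.label b).idx τ.label
  idx_mem c := by
    rw [swapLabel_idx, ← hb]
    exact swap_apply_mem (τ.idx_mem b) (τ.idx_mem b') (τ.idx_mem c)
  existsUnique_idx j hj := by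
    simp only [swapLabel_idx, ← hb, Equiv.swap_apply_eq_iff]
    exact τ.existsUnique_idx _ (swap_apply_mem (τ.idx_mem b) (τ.idx_mem b') hj)
  strict := by
    have hne : ∀ c c', (c.1.1 = c'.1.1 ∨ c.1.2 = c'.1.2) →
        (τ.label c).exp = (τ.label c').exp →
        ¬ ((τ.label c).idx = (τ.label b).idx ∧ (τ.label c').idx = (τ.label b).idx + 1) := by
      rintro c c' hcc hexp ⟨hc, hc'⟩
      obtain rfl := τ.idx_injective hc
      obtain rfl := τ.idx_injective (hc'.trans hb.symm)
      exact hcc.elim (hbb hexp).1 (hbb hexp).2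
    exact ⟨fun c c' hr hc => swapLabel_lt_swapLabel (τ.strict.1 c c' hr hc) (hne c c' (Or.inl hr)),
      fun c c' hc hr => swapLabel_lt_swapLabel (τ.strict.2 c c' hc hr) (hne c c' (Or.inr hc))⟩

variable {τ} {b b' : boxes μ}

theorem row_lt_of_rowBefore (hτ : expo τ.label = T) (hidx : (τ.label b).idx < (τ.label b').idx)
    (h : RowBefore T b' b) (hv : T b = T b') : b'.1.1 < b.1.1 := by
  rcases h with hlt | ⟨-, hr | ⟨hr, hc⟩⟩
  · exact absurd hv hlt.ne'
  · exact hr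
  · subst hτ
    rcases τ.strict.1 b' b hr hc with hlt | ⟨-, hlt⟩
    · exact absurd hv hlt.ne
    · exact absurd hidx hlt.not_gt

/-- The pairs of boxes that `τ` numbers in the order opposite to `RowBefore T`. -/
def rowInv (T : boxes μ → ℕ) (τ : PSYT μ) : Set (boxes μ × boxes μ) :=
  {p | (τ.label p.1).idx < (τ.label p.2).idx ∧ RowBefore T p.2 p.1}

section Swap

variable (hb : (τ.label b').idx = (τ.label b).idx + 1)
  (hbb : (τ.label b).exp = (τ.label b').exp → b.1.1 ≠ b'.1.1 ∧ b.1.2 ≠ b'.1.2)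

theorem swap_idx (c : boxes μ) : ((τ.swap b b' hb hbb).label c).idx =
    Equiv.swap (τ.label b).idx ((τ.label b).idx + 1) (τ.label c).idx :=
  swapLabel_idx ..

theorem swap_idx_left : ((τ.swap b b' hb hbb).label b).idx = (τ.label b).idx + 1 := by
  rw [swap_idx, Equiv.swap_apply_left]

theorem swap_idx_right : ((τ.swap b b' hb hbb).label b').idx = (τ.label b).idx := by
  rw [swap_idx, hb, Equiv.swap_apply_right]

theorem expo_swap : expo (τ.swap b b' hb hbb).label = expo τ.label :=
  funext fun _ => swapLabel_exp ..

theorem ncard_rowInv_swap_lt (h : RowBefore T b' b) :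
    (rowInv T (τ.swap b b' hb hbb)).ncard < (rowInv T τ).ncard := by
  refine Set.ncard_lt_ncard ⟨fun p hp => ⟨?_, hp.2⟩, fun hs => ?_⟩
  · have hlt := hp.1
    rw [swap_idx, swap_idx] at hlt
    refine lt_of_swap_succ_lt_swap_succ hlt fun ⟨h₁, h₂⟩ => irrefl_of (RowBefore T) b' ?_
    obtain rfl := τ.idx_injective (h₁.trans hb.symm)
    obtain rfl := τ.idx_injective h₂
    exact _root_.trans h hp.2
  · have hlt := (hs (a := (b, b')) ⟨hb ▸ Nat.lt_succ_self _, h⟩).1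
    rw [swap_idx_left, swap_idx_right] at hlt
    omega

theorem cover_swap (hT : IsColStrict T) (hτ : expo τ.label = T) (h : RowBefore T b' b) :
    Cover (τ.swap b b' hb hbb) τ := by
  have hexp : ∀ c, ((τ.swap b b' hb hbb).label c).exp = T c :=
    congrFun ((expo_swap hb hbb).trans hτ)
  have hlabel : τ.label = swapLabel (τ.label b).idx (τ.swap b b' hb hbb).label :=
    (swapLabel_swapLabel ..).symm
  rcases lt_or_eq_of_le (show T b' ≤ T b by unfold RowBefore at h; omega) with hlt | heq
  · exact .swap_exp _ _ _ b' b (swap_idx_right hb hbb) (swap_idx_left hb hbb)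
      (by rwa [hexp, hexp]) hlabel
  · refine .swap_content _ _ _ b' b (swap_idx_right hb hbb) (swap_idx_left hb hbb)
      (by rwa [hexp, hexp]) ?_ hlabel
    have hrow := row_lt_of_rowBefore hτ (hb ▸ Nat.lt_succ_self _) h heq.symm
    have := hT.content_add_one_lt heq.symm (hT.col_lt_of_row_lt heq.symm hrow) hrow.ne'
    omega

end Swap

theorem exists_cover_of_rowBefore (hT : IsColStrict T) (hτ : expo τ.label = T)
    (hb : (τ.label b').idx = (τ.label b).idx + 1) (h : RowBefore T b' b) :
    ∃ τ' : PSYT μ, expo τ'.label = T ∧ (rowInv T τ').ncard < (rowInv T τ).ncard ∧ Cover τ' τ := by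
  have hbb : (τ.label b).exp = (τ.label b').exp → b.1.1 ≠ b'.1.1 ∧ b.1.2 ≠ b'.1.2 := fun hexp => by
    have hv : T b = T b' := (congrFun hτ b).symm.trans (hexp.trans (congrFun hτ b'))
    have hrow := row_lt_of_rowBefore hτ (hb ▸ Nat.lt_succ_self _) h hv
    exact ⟨hrow.ne', (hT.col_lt_of_row_lt hv hrow).ne⟩
  exact ⟨τ.swap b b' hb hbb, (expo_swap hb hbb).trans hτ, ncard_rowInv_swap_lt hb hbb h,
    cover_swap hb hbb hT hτ h⟩

theorem eq_minTableau_of_forall_rowBefore (hT : IsColStrict T) (hτ : expo τ.label = T)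
    (h : ∀ b b', (τ.label b').idx = (τ.label b).idx + 1 → RowBefore T b b') :
    τ = minTableau hT := by
  have hpos : ∀ b, (τ.label b).idx - 1 + 1 = (τ.label b).idx := fun b =>
    Nat.sub_add_cancel (mem_Icc.mp (τ.idx_mem b)).1
  have hrank : ∀ b, (τ.label b).idx - 1 = rank (RowBefore T) b := by
    refine eq_rank_of_rel_of_eq_add_one (fun _ => Set.toFinite _) (fun b b' hbb => ?_)
      (fun b k hk => ?_) fun b b' hbb => h b b' ?_
    · exact τ.idx_injective ((hpos b).symm.trans ((congrArg (· + 1) hbb).trans (hpos b')))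
    · have hb := mem_Icc.mp (τ.idx_mem b)
      obtain ⟨c, hc, -⟩ := τ.existsUnique_idx (k + 1) (mem_Icc.mpr (by omega))
      exact ⟨c, by omega⟩
    · rw [← hpos, hbb, hpos]
  refine ext_label (funext fun b => PLabel.ext ?_ (congrFun hτ b))
  exact (hpos b).symm.trans (congrArg (· + 1) (hrank b))

end PSYT

theorem minTableau_le (hT : IsColStrict T) (τ : PSYT μ) (hτ : expo τ.label = T) :
    minTableau hT ≤ τ := by
  induction hk : (τ.rowInv T).ncard using Nat.strong_induction_on generalizing τ with
  | _ k ih =>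
    by_cases h : ∀ b b', (τ.label b').idx = (τ.label b).idx + 1 → RowBefore T b b'
    · rw [τ.eq_minTableau_of_forall_rowBefore hT hτ h]
      exact .refl
    · push Not at h
      obtain ⟨b, b', hb, hbb⟩ := h
      have hne : b ≠ b' := by
        rintro rfl
        omega
      obtain ⟨τ', hτ', hlt, hcover⟩ := τ.exists_cover_of_rowBefore hT hτ hb
        ((trichotomous_of (RowBefore T) b b').resolve_left hbb |>.resolve_left hne)
      exact .tail (ih _ (hk ▸ hlt) τ' hτ' rfl) hcover

theorem isMinTableau_minTableau (hT : IsColStrict T) : IsMinTableau T (minTableau hT) :=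
  ⟨rfl, minTableau_le hT⟩

theorem Cover.exp_le {τ τ' : PSYT μ} (h : Cover τ τ') (b : boxes μ) :
    (τ.label b).exp ≤ (τ'.label b).exp := by
  rcases h with h | ⟨_, _, _, _, _, _, h⟩ | ⟨_, _, _, _, _, _, _, h⟩
  · rw [h, psiLabel]
    split_ifs
    exacts [le_rfl, Nat.le_succ _]
  all_goals rw [h, swapLabel_exp]

theorem PSYT.exp_le_of_le {τ τ' : PSYT μ} (h : τ ≤ τ') (b : boxes μ) :
    (τ.label b).exp ≤ (τ'.label b).exp := by
  replace h : Relation.ReflTransGen Cover τ τ' := h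
  induction h with
  | refl => exact le_rfl
  | tail _ hcover ih => exact ih.trans (hcover.exp_le b)

theorem rowBefore_of_minTableau_label_eq (hT : IsColStrict T) {f : boxes μ → PLabel} {i : ℕ}
    {b b' : boxes μ} (hb : (f b).idx = i) (hb' : (f b').idx = i + 1)
    (h : (minTableau hT).label = swapLabel i f) : RowBefore T b' b := by
  have hrank : ∀ c, rank (RowBefore T) c + 1 = Equiv.swap i (i + 1) (f c).idx := fun c =>
    (congrArg PLabel.idx (congrFun h c)).trans (swapLabel_idx ..)
  have hrank_b := hrank b
  have hrank_b' := hrank b'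
  rw [hb, Equiv.swap_apply_left] at hrank_b
  rw [hb', Equiv.swap_apply_right] at hrank_b'
  exact (rank_lt_rank_iff fun _ => Set.toFinite _).mp (by omega)

theorem isEmpty_of_cover_minTableau (hT : IsColStrict T) {τ : PSYT μ} (hτ : expo τ.label = T)
    (h : Cover τ (minTableau hT)) : IsEmpty (boxes μ) := by
  by_contra hne
  rcases h with h | ⟨_, b₁, b₂, h₁, h₂, hw, h⟩ | ⟨_, b₁, b₂, h₁, h₂, hw, hc, h⟩
  · obtain ⟨c⟩ := not_isEmpty_iff.mp hne
    have hc := mem_Icc.mp (τ.idx_mem c)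
    obtain ⟨b, hb, -⟩ := τ.existsUnique_idx 1 (mem_Icc.mpr ⟨le_rfl, hc.1.trans hc.2⟩)
    have hexp : T b = (psiLabel μ.card τ.label b).exp := congrArg PLabel.exp (congrFun h b)
    rw [psiLabel, if_neg (by omega)] at hexp
    exact absurd (congrFun hτ b) (by rw [hexp]; exact (Nat.lt_succ_self _).ne)
  all_goals
    have hbb := rowBefore_of_minTableau_label_eq hT h₁ h₂ h
    have hexp : ∀ c, (τ.label c).exp = T c := congrFun hτ
    rw [hexp, hexp] at hw
  · unfold RowBefore at hbb
    omega
  · have hrow := PSYT.row_lt_of_rowBefore hτ (by omega) hbb hw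
    have := hT.content_lt hw (hT.col_lt_of_row_lt hw hrow)
    omega

theorem IsMinTableau.eq_minTableau (hT : IsColStrict T) {M : PSYT μ} (hM : IsMinTableau T M) :
    M = minTableau hT := by
  obtain ⟨hexp, hle⟩ := hM
  rcases Relation.ReflTransGen.cases_tail (hle (minTableau hT) rfl) with heq | ⟨τ, hMτ, hcover⟩
  · exact heq.symm
  · have hτ : expo τ.label = T := funext fun b => (hcover.exp_le b).antisymm
      ((congrFun hexp b).ge.trans (PSYT.exp_le_of_le hMτ b))
    have := isEmpty_of_cover_minTableau hT hτ hcover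
    exact PSYT.ext_label (Subsingleton.elim _ _)

end MinTableau

section Runs

variable {D : Set (ℕ × ℕ)} {T : D → ℕ} {b b' c : D}

/-- `b` and `b'` lie in the same row, with the same value of `T`. The boxes of such a run carry
consecutive numbers in `Min(T)`, and the runs are the blocks of the composition `μ(T)`. -/
def SameRun (T : D → ℕ) (b b' : D) : Prop := b.1.1 = b'.1.1 ∧ T b = T b'

theorem SameRun.symm (h : SameRun T b b') : SameRun T b' b := ⟨h.1.symm, h.2.symm⟩

theorem SameRun.trans (h : SameRun T b b') (h' : SameRun T b' c) : SameRun T b c :=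
  ⟨h.1.trans h'.1, h.2.trans h'.2⟩

theorem SameRun.of_not_rowBefore (h : SameRun T b b') (hbc : ¬ RowBefore T c b)
    (hcb : ¬ RowBefore T b' c) : SameRun T b c := by
  unfold SameRun RowBefore at *
  omega

theorem precedes_iff_sameRun (hT : IsColStrict T) (h : RowBefore T b b') :
    Precedes T b b' ↔ SameRun T b b' := by
  constructor
  · intro hp
    have hv : T b = T b' := by
      unfold Precedes at hp
      unfold RowBefore at h
      omega
    have hrow := hT.row_le hv ((hT.precedes_iff_col_lt hv).mp hp)
    unfold RowBefore at h
    exact ⟨by omega, hv⟩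
  · rintro ⟨hrow, hv⟩
    unfold RowBefore at h
    exact (hT.precedes_iff_col_lt hv).mpr (by omega)

theorem RightNext.rank_eq [Finite D] (h : RightNext T b b') :
    rank (RowBefore T) b' = rank (RowBefore T) b + 1 := by
  obtain ⟨hb, hv⟩ := h
  refine rank_eq_rank_add_one (Set.toFinite _) (Or.inr ⟨hv, Or.inr ?_⟩) fun c hbc hcb => ?_
  · rw [hb]
    exact ⟨rfl, Nat.lt_succ_self _⟩
  · unfold RowBefore at hbc hcb
    rw [hb] at hcb
    omega

theorem content_sub_rank_eq [Finite D] (hT : IsColStrict T) (h : SameRun T b b')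
    (hbb : RowBefore T b b') :
    content b'.1 - rank (RowBefore T) b' = content b.1 - rank (RowBefore T) b := by
  have hcol : b.1.2 < b'.1.2 := by
    unfold SameRun RowBefore at *
    omega
  have hstep : ∀ {c c' : D}, RightNext T c c' →
      content c'.1 - rank (RowBefore T) c' = content c.1 - rank (RowBefore T) c := fun hc => by
    rw [hc.rank_eq, (hT.rightNext_iff.mp hc).2]
    push_cast
    ring
  have hpath := hT.transGen_rightNext h.2 h.1 hcol
  clear h hbb hcol
  induction hpath with
  | single hc => exact hstep hc
  | tail _ hc ih => exact (hstep hc).trans ih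

theorem pairRatio_node_eq [Finite D] (hT : IsColStrict T) (h : SameRun T b b')
    (hbb : RowBefore T b b') : pairRatio t (node T b) (node T b') =
      pairRatio t (t ^ rank (RowBefore T) b) (t ^ rank (RowBefore T) b') := by
  have hnode : ∀ c : D, node T c =
      t ^ rank (RowBefore T) c * (q ^ (T c : ℤ) * t ^ (content c.1 - rank (RowBefore T) c)) :=
    fun c => by rw [node, mul_left_comm, ← zpow_natCast, ← zpow_add₀ t_ne_zero, add_sub_cancel]
  rw [hnode b, hnode b', content_sub_rank_eq hT h hbb, h.2]
  exact pairRatio_mul_right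
    (mul_ne_zero (zpow_ne_zero _ q_ne_zero) (zpow_ne_zero _ t_ne_zero))

end Runs

section Blocks

variable {μ : YoungDiagram} {T : boxes μ → ℕ} {i j : Fin μ.card}

/-- The box that carries the number `i + 1` in `Min(T)`. -/
noncomputable def minBox (T : boxes μ → ℕ) : Fin μ.card ≃ boxes μ :=
  finRankEquiv (RowBefore T) (card_boxes μ)

theorem rank_minBox (i : Fin μ.card) : rank (RowBefore T) (minBox T i) = i :=
  rank_finRankEquiv _ i

theorem rowBefore_minBox_iff : RowBefore T (minBox T i) (minBox T j) ↔ i < j :=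
  rel_finRankEquiv_iff _

theorem eq_minBox_iff {b : boxes μ} : b = minBox T i ↔ rank (RowBefore T) b = i := by
  rw [← rank_minBox (T := T) i]
  exact (rank_injective fun _ => Set.toFinite _).eq_iff.symm

theorem joined_minTableau_iff (hT : IsColStrict T) (hij : (j : ℕ) = i + 1) :
    Joined (minTableau hT) j ↔ SameRun T (minBox T i) (minBox T j) := by
  constructor
  · rintro ⟨b, b', hb, hb', hrun⟩
    obtain rfl : b = minBox T i := eq_minBox_iff.mpr (Nat.succ.inj (hb.trans hij))
    obtain rfl : b' = minBox T j := eq_minBox_iff.mpr (Nat.succ.inj hb')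
    exact hrun
  · intro hrun
    refine ⟨minBox T i, minBox T j, ?_, congrArg (· + 1) (rank_minBox j), hrun⟩
    exact (congrArg (· + 1) (rank_minBox i)).trans hij.symm

theorem index_muComp_eq_iff_joined (M : PSYT μ) (hij : i ≤ j) :
    (muComp M).index i = (muComp M).index j ↔
      ∀ b : ℕ, (i : ℕ) < b → b ≤ j → Joined M b := by
  rw [index_eq_iff_forall_notMem_boundaries _ hij]
  simp only [muComp, CompositionAsSet.toComposition_boundaries, mem_filter, mem_univ, true_and,
    not_or, not_not]
  refine ⟨fun h b hib hbj => (h ⟨b, by omega⟩ hib hbj).2.2, fun h b hib hbj =>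
    ⟨?_, ?_, h b hib hbj⟩⟩
  · rintro rfl
    exact absurd hib (Nat.not_lt_zero _)
  · rintro rfl
    exact absurd hbj j.is_lt.not_ge

theorem index_muComp_eq_iff (hT : IsColStrict T) (hij : i ≤ j) :
    (muComp (minTableau hT)).index i = (muComp (minTableau hT)).index j ↔
      SameRun T (minBox T i) (minBox T j) := by
  rw [index_muComp_eq_iff_joined _ hij]
  constructor
  · intro h
    have hrun : ∀ d (hd : (i : ℕ) + d ≤ j),
        SameRun T (minBox T i) (minBox T ⟨i + d, by omega⟩) := by
      intro d
      induction d with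
      | zero => exact fun _ => ⟨rfl, rfl⟩
      | succ d ih =>
        exact fun hd => (ih (by omega)).trans
          ((joined_minTableau_iff hT rfl).mp (h (i + d + 1) (by omega) hd))
    have hj : (⟨i + (j - i), by omega⟩ : Fin μ.card) = j := Fin.ext (Nat.add_sub_cancel' hij)
    exact hj ▸ hrun (j - i) (by omega)
  · intro h b hib hbj
    have hmid : ∀ k : Fin μ.card, i ≤ k → k ≤ j → SameRun T (minBox T i) (minBox T k) :=
      fun k hik hkj => h.of_not_rowBefore (by rw [rowBefore_minBox_iff]; exact hik.not_gt)
        (by rw [rowBefore_minBox_iff]; exact hkj.not_gt)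
    have hleft := hmid ⟨b - 1, by omega⟩ (Nat.le_sub_one_of_lt hib)
      ((Nat.sub_le _ _).trans hbj)
    have hright := hmid ⟨b, by omega⟩ hib.le hbj
    exact (joined_minTableau_iff hT (Nat.sub_add_cancel (Nat.one_le_of_lt hib)).symm).mpr
      (hleft.symm.trans hright)

open Classical in
theorem prod_not_inverted (hT : IsColStrict T) :
    ∏ b : boxes μ, ∏ b' : boxes μ, (if Precedes T b b' ∧ RowBefore T b b' then
      pairRatio t (node T b) (node T b') else 1) =
      (tFactorialComp (muComp (minTableau hT)))⁻¹ := by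
  rw [tFactorialComp, show tFactorial = fun m => ∏ i ∈ Icc 1 m, (1 - t ^ i) / (1 - t) from rfl,
    ← prod_index_eq_pairRatio _ t_ne_zero t_pow_succ_ne_one, Finset.prod_comm,
    ← (minBox T).prod_comp]
  refine prod_congr rfl fun j _ => ?_
  rw [← (minBox T).prod_comp]
  refine prod_congr rfl fun i _ => ?_
  by_cases hij : i < j
  · have hbb : RowBefore T (minBox T i) (minBox T j) := rowBefore_minBox_iff.mpr hij
    simp only [hbb, hij, precedes_iff_sameRun hT hbb, index_muComp_eq_iff hT hij.le, and_true,
      true_and]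
    refine if_ctx_congr Iff.rfl (fun hrun => ?_) fun _ => rfl
    rw [pairRatio_node_eq hT hrun hbb, rank_minBox, rank_minBox]
  · rw [if_neg fun h => hij (rowBefore_minBox_iff.mp h.2), if_neg fun h => hij h.1]

theorem mem_Inv_minTableau (hT : IsColStrict T) {p : boxes μ × boxes μ} :
    p ∈ Inv (minTableau hT).label ↔ Precedes T p.1 p.2 ∧ RowBefore T p.2 p.1 :=
  and_congr (stdLabel_lt_iff fun _ => Set.toFinite _)
    (Nat.succ_lt_succ_iff.trans (rank_lt_rank_iff fun _ => Set.toFinite _))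

open Classical in
theorem finprod_Inv_minTableau (hT : IsColStrict T) :
    ∏ᶠ p ∈ Inv (minTableau hT).label, pairFactor T p 0 / pairFactor T p 1 =
      ∏ b : boxes μ, ∏ b' : boxes μ, (if Precedes T b b' ∧ RowBefore T b' b then
        pairRatio t (node T b) (node T b') else 1) := by
  have hset : Inv (minTableau hT).label =
      ((univ.filter fun p => Precedes T p.1 p.2 ∧ RowBefore T p.2 p.1 :
        Finset (boxes μ × boxes μ)) : Set (boxes μ × boxes μ)) :=
    Set.ext fun p => by rw [mem_coe, mem_filter_univ, mem_Inv_minTableau]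
  rw [hset, finprod_mem_coe_finset, prod_filter, ← univ_product_univ, prod_product]
  simp only [pairFactor_zero_div_one]

open Classical in
theorem prod_precedes_eq (hT : IsColStrict T) :
    ∏ b : boxes μ, ∏ b' : boxes μ, (if Precedes T b b' then
      pairRatio t (node T b) (node T b') else 1) =
      (tFactorialComp (muComp (minTableau hT)))⁻¹ *
        ∏ᶠ p ∈ Inv (minTableau hT).label, pairFactor T p 0 / pairFactor T p 1 := by
  rw [finprod_Inv_minTableau, ← prod_not_inverted hT, ← prod_mul_distrib]
  refine prod_congr rfl fun b _ => ?_
  rw [← prod_mul_distrib]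
  refine prod_congr rfl fun b' _ => ?_
  rcases trichotomous_of (RowBefore T) b b' with h | rfl | h
  · simp only [h, asymm h, and_true, and_false, if_false, mul_one]
  · simp only [irrefl_of (Precedes T) b, false_and, if_false, mul_one]
  · simp only [h, asymm h, and_true, and_false, if_false, one_mul]

end Blocks

namespace Omega

variable {lam : YoungDiagram} (T : Omega lam)

/-- The boxes of `λ^{(rk T)}`, which are the first `rk T` boxes of `λ^{(∞)}`, in the order defined
by `T`. -/
noncomputable def headBox : Fin T.rk ≃ boxes (pad lam T.rk) where
  toFun i := ⟨(T.box i).1, (T.box_mem_pad_iff i).mpr i.is_lt⟩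
  invFun b := ⟨T.box.symm ⟨b.1, pad_subset_padInf lam _ b.2⟩, by
    rw [← T.box_mem_pad_iff, Equiv.apply_symm_apply]
    exact b.2⟩
  left_inv i := Fin.ext (T.box.symm_apply_apply i)
  right_inv b := by simp

theorem precedes_headBox_iff {i j : Fin T.rk} :
    Precedes (T.restrict T.rk) (T.headBox i) (T.headBox j) ↔ i < j :=
  T.precedes_box_iff (i := i) (j := j)

theorem prod_one_sub_nodes_div :
    ∏ i ∈ range T.rk, (1 - T.nodes T.rk / T.nodes i) =
      ∏ b : boxes (pad lam T.rk), (1 - q ^ (-(T.restrict T.rk b : ℤ)) *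
        t ^ ((T.rk : ℤ) - (lam.card : ℤ) - content b.1)) := by
  rw [← T.headBox.prod_comp, prod_range]
  refine prod_congr rfl fun i _ => ?_
  change _ = 1 - q ^ (-(T.val (T.box i) : ℤ)) * t ^ (_ - content (T.box i).1)
  rw [T.nodes_eq le_rfl, nodes, node, zpow_neg, zpow_sub₀ t_ne_zero _ (content _),
    div_mul_eq_div_div_swap, div_eq_inv_mul]

open Classical in
theorem prod_pairRatio_nodes :
    ∏ j ∈ range T.rk, ∏ i ∈ range j, pairRatio t (T.nodes i) (T.nodes j) =
      ∏ b : boxes (pad lam T.rk), ∏ b' : boxes (pad lam T.rk),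
        (if Precedes (T.restrict T.rk) b b' then
          pairRatio t (node (T.restrict T.rk) b) (node (T.restrict T.rk) b') else 1) := by
  rw [← prod_fin_Ioi_eq_range fun i j => pairRatio t (T.nodes i) (T.nodes j),
    ← T.headBox.prod_comp]
  refine prod_congr rfl fun i _ => ?_
  rw [← T.headBox.prod_comp, ← filter_lt_eq_Ioi, prod_filter]
  exact prod_congr rfl fun j _ => if_congr T.precedes_headBox_iff.symm rfl rfl

theorem productSide_minTableau :
    productSide T (minTableau (T.isColStrict_restrict T.rk)) =
      (∏ i ∈ range T.rk, (1 - T.nodes T.rk / T.nodes i)) / (1 - t) ^ T.rk *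
        ∏ j ∈ range T.rk, ∏ i ∈ range j, pairRatio t (T.nodes i) (T.nodes j) := by
  rw [prod_pairRatio_nodes, prod_precedes_eq (T.isColStrict_restrict T.rk),
    prod_one_sub_nodes_div, productSide, div_mul_eq_div_div]
  ring

end Omega

end VVMac

/-- For `T ∈ Ω(λ)` the tableau `Min(T|_{λ^{(rk T)}})` exists and is unique, every
`τ ∈ APSYT(λ; T)` has finitely many inversion pairs, and the series over `APSYT(λ; T)` converges
`t`-adically to the product side. -/
theorem mainTheorem5 (lam : YoungDiagram) (T : VVMac.Omega lam) :
    (∃! M : VVMac.PSYT (VVMac.pad lam T.rk), VVMac.IsMinTableau (T.restrict T.rk) M) ∧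
    (∀ τ : VVMac.APSYTOver T, (VVMac.Inv τ.1.label).Finite) ∧
    ∀ M : VVMac.PSYT (VVMac.pad lam T.rk), VVMac.IsMinTableau (T.restrict T.rk) M →
      HasSum (fun τ : VVMac.APSYTOver T => VVMac.seriesTerm T τ) (VVMac.productSide T M) := by
  have hT := T.isColStrict_restrict T.rk
  refine ⟨⟨VVMac.minTableau hT, VVMac.isMinTableau_minTableau hT, fun M hM =>
    hM.eq_minTableau hT⟩, fun τ => τ.finite_Inv, fun M hM => ?_⟩
  rw [hM.eq_minTableau hT, T.productSide_minTableau]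
  exact VVMac.hasSum_seriesTerm T
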